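/- **Conventions.** A theory $T$ is *finite-dimensional* if there is a function $\dim$ from the interpretable sets in models of $T$ to $\mathbb N\cup\{-\infty\}$ such that: $\dim\varphi(x,a)=\dim\varphi(x,a')$ whenever $a,a'$ have the same type over $\emptyset$; $\dim\emptyset=-\infty$, and a nonempty $X$ has $\dim X=0$ if and only if $X$ is finite; $\dim(X\cup Y)=\max\{\dim X,\dim Y\}$; and for every interpretable $f:X\to Y$ and $k\in\mathbb N$, if $\dim f^{-1}(y)\ge k$ for all $y\in Y$ then $\dim X\ge\dim Y+k$, and if $\dim f^{-1}(y)\le k$ for all $y\in Y$ then $\dim X\le \dim Y+k$. "Definable" allows parameters and imaginaries (interpretable sets). For a Lie ring $\mathfrak g$ acting on an abelian group $A$, an ideal $\mathfrak h\trianglelefteq\mathfrak g$ and a $\mathfrak g$-submodule $B\le A$ put $\widetilde C_A(\mathfrak h)=\{a\in A:\ \mathfrak h\cdot a\text{ is finite}\}$ (a $\mathfrak g$-submodule) and $\widetilde C_{\mathfrak h}(B)=\{x\in\mathfrak h:\ x\cdot B\text{ is finite}\}$ (an ideal of $\mathfrak g$). A *partial homomorphism* $f$ from $\mathfrak g$ to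 $A$ is a homomorphism of groups $f:\operatorname{Dom}(f)\to A$, where $\operatorname{Dom}(f)$ is a subgroup of finite index in $(\mathfrak g,+)$; write $f\sim f'$ if $f-f'$, defined on $\operatorname{Dom}(f)\cap\operatorname{Dom}(f')$, has finite image. For $g\in\operatorname{Dom}(f)$ let $D^f_g$ be the group of all $x\in\operatorname{Dom}(f)$ with $[g,x]\in\operatorname{Dom}(f)$ and $f([g,x])=g f(x)-x f(g)$. Then $f$ is an *almost derivation* if $D^f=\{g\in\operatorname{Dom}(f): D^f_g\text{ has finite index in }\mathfrak g\}$ has finite index in $\mathfrak g$. The classes $[f]$ of almost derivations modulo $\sim$ form a group $\operatorname{AlmDer}(\mathfrak g,A)$ under addition, and $$\widetilde H^1(\mathfrak g,A)=\operatorname{AlmDer}(\mathfrak g,A)/\{[da]:a\in A\},\qquad da(g)=g\cdot a .$$ **Statement.** Let $\mathfrak g$ be a Lie ring acting on an abelian group $A$, such that $\mathfrak g$, $A$ and the action are definable in a model of a finite-dimensional theory. Assume that $\widetilde C_A(\mathfrak g)=\{0\}$. Let $\mathfrak h\trianglelefteq\mathfrak g$ be a definable ideal, and let $\mathfrak h_1$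 be the ideal $\widetilde C_{\mathfrak h}(\widetilde C_A(\mathfrak h))$ of $\mathfrak g$. Then $\mathfrak h_1$ acts trivially on $\widetilde C_A(\mathfrak h)$, so that $\mathfrak g/\mathfrak h_1$ acts on $\widetilde C_A(\mathfrak h)$, and the sequence of abelian groups $$0\longrightarrow\widetilde H^1(\mathfrak g/\mathfrak h_1,\widetilde C_A(\mathfrak h))\xrightarrow{\ inf'\ }\widetilde H^1(\mathfrak g,A)\xrightarrow{\ res\ }\widetilde H^1(\mathfrak h,A)$$ is exact. Here $inf'$ is the composition of the inflation $\widetilde H^1(\mathfrak g/\mathfrak h_1,\widetilde C_A(\mathfrak h))\to\widetilde H^1(\mathfrak g,\widetilde C_A(\mathfrak h))$, which sends the class of $f$ to the class of $g\mapsto f(g+\mathfrak h_1)$ on the preimage of $\operatorname{Dom}(f)$, with the map $\widetilde H^1(\mathfrak g,\widetilde C_A(\mathfrak h))\to\widetilde H^1(\mathfrak g,A)$ induced by the inclusion; and $res$ sends the class of $f$ to the class of its restriction to $\mathfrak h\cap\operatorname{Dom}(f)$. -/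

import Mathlib

/-! ## Finite-dimensional theories -/

universe u v w u₁ u₂

namespace AlmCoh

section Interpretable

variable {L : FirstOrder.Language.{u, v}} {M : Type w} [L.Structure M]

/-- An interpretable set of `M`: a definable subset of `M ^ n` modulo a definable equivalence
relation. Definable means definable with parameters from `M` throughout. -/
structure InterpretableSet (L : FirstOrder.Language.{u, v}) (M : Type w) [L.Structure M]
    (n : ℕ) where
  /-- the definable set of representatives -/
  carrier : Set (Fin n → M)
  /-- the equivalence relation that is factored out -/
  rel : Setoid carrier
  definable_carrier : (Set.univ : Set M).Definable L carrier
  definable_rel : (Set.univ : Set M).Definable L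
    {v : Fin n ⊕ Fin n → M | ∃ x y : carrier, v = Sum.elim x.1 y.1 ∧ rel x y}

namespace InterpretableSet

variable {n m k : ℕ}

/-- The elements of an interpretable set: the equivalence classes. -/
def Points (X : InterpretableSet L M n) : Type w := Quotient X.rel

/-- The tuple `x` is a representative of the point `p`. -/
def Codes (X : InterpretableSet L M n) (x : Fin n → M) (p : X.Points) : Prop :=
  ∃ hx : x ∈ X.carrier, (Quotient.mk X.rel ⟨x, hx⟩ : X.Points) = p

/-- A set of points is definable if the set of its representatives is. -/
def IsDefinable (X : InterpretableSet L M n) (S : Set X.Points) : Prop :=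
  (Set.univ : Set M).Definable L {x : Fin n → M | ∃ p ∈ S, X.Codes x p}

/-- A map between interpretable sets is interpretable if its graph is definable. -/
def IsInterpretableMap (X : InterpretableSet L M n) (Y : InterpretableSet L M m)
    (f : X.Points → Y.Points) : Prop :=
  (Set.univ : Set M).Definable L
    {v : Fin n ⊕ Fin m → M | ∃ p, X.Codes (v ∘ Sum.inl) p ∧ Y.Codes (v ∘ Sum.inr) (f p)}

/-- A definable subset of an interpretable set, as an interpretable set. -/
def restrict (X : InterpretableSet L M n) (S : Set X.Points) (hS : X.IsDefinable S) :
    InterpretableSet L M n where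
  carrier := {x | ∃ p ∈ S, X.Codes x p}
  rel := X.rel.comap fun x => ⟨x.1, x.2.choose_spec.2.choose⟩
  definable_carrier := hS
  definable_rel := by
    have h1 := (hS.preimage_comp (Sum.inl : Fin n → Fin n ⊕ Fin n)).inter
      (hS.preimage_comp (Sum.inr : Fin n → Fin n ⊕ Fin n))
    refine (congr rfl (Set.ext fun v => ?_)).mp (h1.inter X.definable_rel)
    constructor
    · rintro ⟨⟨hx, hy⟩, x, y, rfl, hxy⟩
      exact ⟨⟨x.1, hx⟩, ⟨y.1, hy⟩, rfl, hxy⟩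
    · rintro ⟨x, y, rfl, hxy⟩
      exact ⟨⟨x.2, y.2⟩, ⟨x.1, x.2.choose_spec.2.choose⟩, ⟨y.1, y.2.choose_spec.2.choose⟩,
        rfl, hxy⟩

theorem IsDefinable.union {X : InterpretableSet L M n} {S S' : Set X.Points}
    (hS : X.IsDefinable S) (hS' : X.IsDefinable S') : X.IsDefinable (S ∪ S') := by
  unfold IsDefinable
  refine (congr rfl (Set.ext fun v => ?_)).mp (Set.Definable.union hS hS')
  constructor
  · rintro (⟨p, hp, h⟩ | ⟨p, hp, h⟩)
    · exact ⟨p, Or.inl hp, h⟩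
    · exact ⟨p, Or.inr hp, h⟩
  · rintro ⟨p, hp | hp, h⟩
    · exact Or.inl ⟨p, hp, h⟩
    · exact Or.inr ⟨p, hp, h⟩

/-- The fibres of an interpretable map are definable. -/
theorem IsInterpretableMap.fiber {X : InterpretableSet L M n} {Y : InterpretableSet L M m}
    {f : X.Points → Y.Points} (hf : X.IsInterpretableMap Y f) (y : Y.Points) :
    X.IsDefinable (f ⁻¹' {y}) := by
  obtain ⟨b, hb⟩ := Quotient.exists_rep y
  have h1 : (Set.univ : Set M).Definable L
      {v : Fin n ⊕ Fin m → M | ∀ i, v (Sum.inr i) = b.1 i} := by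
    have : ∀ i, (Set.univ : Set M).Definable L {v : Fin n ⊕ Fin m → M | v (Sum.inr i) = b.1 i} :=
      fun i => (Set.Definable.singleton_of_mem (L := L) (Set.mem_univ (b.1 i))).preimage_comp
        (fun _ : Fin 1 => (Sum.inr i : Fin n ⊕ Fin m))
    refine (congr rfl (Set.ext fun v => ?_)).mp (Set.definable_iInter_of_finite this)
    simp
  unfold IsDefinable
  refine (congr rfl (Set.ext fun x => ?_)).mp
    ((Set.Definable.inter hf h1).image_comp (Sum.inl : Fin n → Fin n ⊕ Fin m))
  constructor
  · rintro ⟨v, ⟨⟨p, hp, hb', hfp⟩, hv⟩, rfl⟩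
    refine ⟨p, ?_, hp⟩
    have : (⟨v ∘ Sum.inr, hb'⟩ : Y.carrier) = b := Subtype.ext (funext hv)
    rw [this] at hfp
    exact (hfp.symm.trans hb)
  · rintro ⟨p, hp, hx⟩
    have hp' : f p = y := hp
    refine ⟨Sum.elim x b.1, ⟨⟨p, by simpa using hx, b.2, ?_⟩, fun i => rfl⟩, by simp⟩
    rw [hp']
    exact hb

/-- `X` is the interpretable set that the formulas `φ` (for the set of representatives) and `ε`
(for the equivalence relation) define when the parameters `a` are inserted. -/
def IsDefinedBy (X : InterpretableSet L M n) (φ : L.Formula (Fin n ⊕ Fin k))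
    (ε : L.Formula ((Fin n ⊕ Fin n) ⊕ Fin k)) (a : Fin k → M) : Prop :=
  (∀ x, x ∈ X.carrier ↔ φ.Realize (Sum.elim x a)) ∧
    ∀ x y : X.carrier, X.rel x y ↔ ε.Realize (Sum.elim (Sum.elim x.1 y.1) a)

end InterpretableSet

open InterpretableSet in
/-- A dimension on all interpretable sets in all models of `T`, with values in `ℕ ∪ {-∞}`. -/
structure Dimension {L : FirstOrder.Language.{u, v}} (T : L.Theory) where
  /-- the dimension of an interpretable set in a model of `T` -/
  dim : ∀ (N : T.ModelType.{u, v, w}) {n : ℕ}, InterpretableSet L N n → WithBot ℕ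
  /-- the dimension depends only on the formulas and on the type over `∅` of the parameters -/
  invariance : ∀ (N N' : T.ModelType.{u, v, w}) {n k : ℕ} (φ : L.Formula (Fin n ⊕ Fin k))
    (ε : L.Formula ((Fin n ⊕ Fin n) ⊕ Fin k)) (a : Fin k → N) (a' : Fin k → N')
    (X : InterpretableSet L N n) (X' : InterpretableSet L N' n),
    (∀ ψ : L.Formula (Fin k), ψ.Realize a ↔ ψ.Realize a') →
    X.IsDefinedBy φ ε a → X'.IsDefinedBy φ ε a' → dim N X = dim N' X'
  empty : ∀ (N : T.ModelType.{u, v, w}) {n : ℕ} (X : InterpretableSet L N n),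
    IsEmpty X.Points → dim N X = ⊥
  algebraicity : ∀ (N : T.ModelType.{u, v, w}) {n : ℕ} (X : InterpretableSet L N n),
    Nonempty X.Points → (dim N X = 0 ↔ Finite X.Points)
  union : ∀ (N : T.ModelType.{u, v, w}) {n : ℕ} (Z : InterpretableSet L N n) (S S' : Set Z.Points)
    (hS : Z.IsDefinable S) (hS' : Z.IsDefinable S'),
    dim N (Z.restrict (S ∪ S') (hS.union hS')) =
      max (dim N (Z.restrict S hS)) (dim N (Z.restrict S' hS'))
  upper_fibration : ∀ (N : T.ModelType.{u, v, w}) {n m : ℕ} (X : InterpretableSet L N n)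
    (Y : InterpretableSet L N m) (f : X.Points → Y.Points) (hf : X.IsInterpretableMap Y f) (k : ℕ),
    (∀ y, (k : WithBot ℕ) ≤ dim N (X.restrict (f ⁻¹' {y}) (hf.fiber y))) →
      dim N Y + (k : WithBot ℕ) ≤ dim N X
  lower_fibration : ∀ (N : T.ModelType.{u, v, w}) {n m : ℕ} (X : InterpretableSet L N n)
    (Y : InterpretableSet L N m) (f : X.Points → Y.Points) (hf : X.IsInterpretableMap Y f) (k : ℕ),
    (∀ y, dim N (X.restrict (f ⁻¹' {y}) (hf.fiber y)) ≤ (k : WithBot ℕ)) →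
      dim N X ≤ dim N Y + (k : WithBot ℕ)

/-- `T` is a finite-dimensional theory. -/
def IsFiniteDimensional {L : FirstOrder.Language.{u, v}} (T : L.Theory) : Prop :=
  Nonempty (Dimension.{u, v, w} T)

/-- An identification of the elements of `G` with the points of an interpretable set of `M`. -/
structure Interpretation (L : FirstOrder.Language.{u, v}) (M : Type w) [L.Structure M]
    (G : Type*) where
  /-- the length of the tuples that represent elements of `G` -/
  arity : ℕ
  /-- the interpretable set -/
  set : InterpretableSet L M arity
  /-- the identification -/
  equiv : set.Points ≃ G

namespace Interpretation

variable {G H K : Type*}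

/-- The tuple `x` is a representative of the element `g`. -/
def Codes (I : Interpretation L M G) (x : Fin I.arity → M) (g : G) : Prop :=
  I.set.Codes x (I.equiv.symm g)

/-- A subset of `G` is definable in `M`. -/
def IsDefinable (I : Interpretation L M G) (S : Set G) : Prop :=
  (Set.univ : Set M).Definable L {x : Fin I.arity → M | ∃ g ∈ S, I.Codes x g}

/-- A binary operation `G × H → K` is definable in `M`: its graph is definable. -/
def IsDefinableOp (I : Interpretation L M G) (J : Interpretation L M H)
    (K' : Interpretation L M K) (op : G → H → K) : Prop :=
  (Set.univ : Set M).Definable L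
    {v : (Fin I.arity ⊕ Fin J.arity) ⊕ Fin K'.arity → M | ∃ g h,
      I.Codes (v ∘ Sum.inl ∘ Sum.inl) g ∧ J.Codes (v ∘ Sum.inl ∘ Sum.inr) h ∧
        K'.Codes (v ∘ Sum.inr) (op g h)}

end Interpretation

/-- The Lie ring `𝔤`, the abelian group `A` and the action of `𝔤` on `A` are definable in `M`. -/
structure DefinableModule (L : FirstOrder.Language.{u, v}) (M : Type w) [L.Structure M]
    (𝔤 A : Type*) [LieRing 𝔤] [AddCommGroup A] [LieRingModule 𝔤 A] where
  /-- the interpretable set underlying `𝔤` -/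
  ring : Interpretation L M 𝔤
  /-- the interpretable set underlying `A` -/
  group : Interpretation L M A
  definable_add_ring : ring.IsDefinableOp ring ring fun x y => x + y
  definable_bracket : ring.IsDefinableOp ring ring fun x y => ⁅x, y⁆
  definable_add_group : group.IsDefinableOp group group fun a b => a + b
  definable_action : ring.IsDefinableOp group group fun x a => ⁅x, a⁆

end Interpretable

/-! ## Almost centralisers -/

/-- `H` is almost contained in `K`: the subgroup `H ∩ K` has finite index in `H`. -/
def AlmostLE {G : Type*} [AddCommGroup G] (H K : AddSubgroup G) : Prop :=
  (K.addSubgroupOf H).FiniteIndex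

theorem almostLE_bot_iff {G : Type*} [AddCommGroup G] (H : AddSubgroup G) :
    AlmostLE H ⊥ ↔ (H : Set G).Finite := by
  have h : (⊥ : AddSubgroup G).relIndex H = Nat.card H := AddSubgroup.relIndex_bot_left H
  rw [AddSubgroup.relIndex] at h
  rw [AlmostLE, AddSubgroup.finiteIndex_iff, h, ← Nat.pos_iff_ne_zero, Nat.card_pos_iff]
  exact ⟨fun h => Set.finite_coe_iff.1 h.2, fun h => ⟨⟨0⟩, h.to_subtype⟩⟩

section Centraliser

variable {𝔤 A : Type*} [LieRing 𝔤] [AddCommGroup A] [LieRingModule 𝔤 A]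

/-- The action of one Lie ring element, as an endomorphism of the abelian group `A`. -/
def actLeft (A : Type*) [AddCommGroup A] [LieRingModule 𝔤 A] (x : 𝔤) : A →+ A where
  toFun a := ⁅x, a⁆
  map_zero' := lie_zero x
  map_add' := lie_add x

/-- The orbit map `x ↦ x · a`. -/
def actRight (𝔤 : Type*) [LieRing 𝔤] [LieRingModule 𝔤 A] (a : A) : 𝔤 →+ A where
  toFun x := ⁅x, a⁆
  map_zero' := zero_lie a
  map_add' x y := add_lie x y a

@[simp] theorem actLeft_apply (x : 𝔤) (a : A) : actLeft A x a = ⁅x, a⁆ := rfl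

@[simp] theorem actRight_apply (x : 𝔤) (a : A) : actRight 𝔤 a x = ⁅x, a⁆ := rfl

/-- The almost centraliser of the ideal `𝔥` in `A`: all `a` such that `𝔥 · a` is almost contained
in `0`. It is a `𝔤`-submodule. -/
def almostCentralizerIn (A : Type*) [AddCommGroup A] [LieRingModule 𝔤 A] (𝔥 : LieIdeal ℤ 𝔤) :
    LieSubmodule ℤ 𝔤 A where
  carrier := {a | AlmostLE (𝔥.toSubmodule.toAddSubgroup.map (actRight 𝔤 a)) ⊥}
  zero_mem' := by
    rw [Set.mem_ofPred_eq, almostLE_bot_iff]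
    refine (Set.finite_singleton (0 : A)).subset ?_
    rintro _ ⟨x, -, rfl⟩
    simp
  add_mem' := by
    intro a b ha hb
    rw [Set.mem_ofPred_eq, almostLE_bot_iff] at ha hb ⊢
    refine (ha.add hb).subset ?_
    rintro _ ⟨x, hx, rfl⟩
    exact ⟨_, ⟨x, hx, rfl⟩, _, ⟨x, hx, rfl⟩, (lie_add x a b).symm⟩
  smul_mem' := by
    intro n a ha
    rw [Set.mem_ofPred_eq, almostLE_bot_iff] at ha ⊢
    refine (ha.image fun b => n • b).subset ?_
    rintro _ ⟨x, hx, rfl⟩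
    exact ⟨_, ⟨x, hx, rfl⟩, (lie_zsmul x a n).symm⟩
  lie_mem := by
    intro g a ha
    have ha' : AlmostLE (𝔥.toSubmodule.toAddSubgroup.map (actRight 𝔤 a)) ⊥ := ha
    change AlmostLE (𝔥.toSubmodule.toAddSubgroup.map (actRight 𝔤 ⁅g, a⁆)) ⊥
    rw [almostLE_bot_iff] at ha' ⊢
    refine (ha'.add (ha'.image fun b => ⁅g, b⁆)).subset ?_
    rintro _ ⟨x, hx, rfl⟩
    refine ⟨⁅⁅x, g⁆, a⁆, ⟨⁅x, g⁆, lie_mem_left ℤ 𝔤 𝔥 x g hx, rfl⟩, ⁅g, ⁅x, a⁆⁆,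
      ⟨_, ⟨x, hx, rfl⟩, rfl⟩, ?_⟩
    exact (leibniz_lie x g a).symm

/-- The almost centraliser of the submodule `B` in the ideal `𝔥`: all `x ∈ 𝔥` such that `x · B` is
almost contained in `0`. It is an ideal of `𝔤`. -/
def almostCentralizerOf (𝔥 : LieIdeal ℤ 𝔤) (B : LieSubmodule ℤ 𝔤 A) : LieIdeal ℤ 𝔤 where
  carrier := {x | x ∈ 𝔥 ∧ AlmostLE (B.toSubmodule.toAddSubgroup.map (actLeft A x)) ⊥}
  zero_mem' := by
    rw [Set.mem_ofPred_eq, almostLE_bot_iff]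
    refine ⟨𝔥.zero_mem, (Set.finite_singleton (0 : A)).subset ?_⟩
    rintro _ ⟨a, -, rfl⟩
    simp
  add_mem' := by
    intro x y hx hy
    rw [Set.mem_ofPred_eq, almostLE_bot_iff] at hx hy ⊢
    refine ⟨𝔥.add_mem hx.1 hy.1, (hx.2.add hy.2).subset ?_⟩
    rintro _ ⟨a, ha, rfl⟩
    exact ⟨_, ⟨a, ha, rfl⟩, _, ⟨a, ha, rfl⟩, (add_lie x y a).symm⟩
  smul_mem' := by
    intro n x hx
    rw [Set.mem_ofPred_eq, almostLE_bot_iff] at hx ⊢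
    refine ⟨𝔥.smul_mem n hx.1, (hx.2.image fun b => n • b).subset ?_⟩
    rintro _ ⟨a, ha, rfl⟩
    exact ⟨_, ⟨a, ha, rfl⟩, (zsmul_lie x a n).symm⟩
  lie_mem := by
    intro g x hx
    have hx' : x ∈ 𝔥 ∧ AlmostLE (B.toSubmodule.toAddSubgroup.map (actLeft A x)) ⊥ := hx
    change ⁅g, x⁆ ∈ 𝔥 ∧ AlmostLE (B.toSubmodule.toAddSubgroup.map (actLeft A ⁅g, x⁆)) ⊥
    rw [almostLE_bot_iff] at hx' ⊢
    refine ⟨𝔥.lie_mem hx'.1, ((hx'.2.image fun b => ⁅g, b⁆).sub hx'.2).subset ?_⟩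
    rintro _ ⟨a, ha, rfl⟩
    exact ⟨⁅g, ⁅x, a⁆⁆, ⟨_, ⟨a, ha, rfl⟩, rfl⟩, ⁅x, ⁅g, a⁆⁆, ⟨⁅g, a⁆, B.lie_mem ha, rfl⟩,
      (lie_lie g x a).symm⟩

/-- If the ideal `I` acts trivially on the submodule `B`, then the quotient `𝔤 ⧸ I` acts on `B`. -/
@[reducible]
def quotientModule (I : LieIdeal ℤ 𝔤) (B : LieSubmodule ℤ 𝔤 A)
    (h : ∀ x ∈ I, ∀ b ∈ B, ⁅x, b⁆ = 0) : LieRingModule (𝔤 ⧸ I) B where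
  bracket q b := Quotient.liftOn' q (fun x => ⁅x, b⁆) fun x y hxy => by
    have hxy' : x - y ∈ I := (Submodule.quotientRel_def I.toSubmodule).1 hxy
    have := h _ hxy' b.1 b.2
    rw [sub_lie, sub_eq_zero] at this
    exact Subtype.ext this
  add_lie x y b := by
    induction x, y using Quotient.inductionOn₂' with | _ x y
    exact add_lie x y b
  lie_add x a b := by
    induction x using Quotient.inductionOn' with | _ x
    exact lie_add x a b
  leibniz_lie x y b := by
    induction x, y using Quotient.inductionOn₂' with | _ x y
    exact leibniz_lie x y b

end Centraliser

/-! ## Partial homomorphisms -/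

/-- A partial homomorphism from `G` to `H`: a homomorphism to `H` from a subgroup of finite index
of `G`. -/
structure PartialHom (G H : Type*) [AddCommGroup G] [AddCommGroup H] where
  /-- the domain -/
  dom : AddSubgroup G
  finiteIndex : dom.FiniteIndex
  /-- the homomorphism -/
  toFun : dom →+ H

namespace PartialHom

variable {G H : Type*} [AddCommGroup G] [AddCommGroup H]

instance : Zero (PartialHom G H) := ⟨⟨⊤, inferInstance, 0⟩⟩

instance : Add (PartialHom G H) :=
  ⟨fun f f' =>
    { dom := f.dom ⊓ f'.dom
      finiteIndex := by
        have := f.finiteIndex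
        have := f'.finiteIndex
        infer_instance
      toFun := f.toFun.comp (AddSubgroup.inclusion inf_le_left) +
        f'.toFun.comp (AddSubgroup.inclusion inf_le_right) }⟩

instance : Neg (PartialHom G H) := ⟨fun f => ⟨f.dom, f.finiteIndex, -f.toFun⟩⟩

instance : Sub (PartialHom G H) := ⟨fun f f' => f + -f'⟩

/-- `f ∼ f'` if `f - f'` has finite image. -/
def Equivalent (f f' : PartialHom G H) : Prop := (Set.range (f - f').toFun).Finite

/-- `f` and `f'` are defined on `K` and agree there. -/
def AgreeOn (f f' : PartialHom G H) (K : AddSubgroup G) : Prop :=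
  ∀ x ∈ K, ∃ (hx : x ∈ f.dom) (hx' : x ∈ f'.dom), f.toFun ⟨x, hx⟩ = f'.toFun ⟨x, hx'⟩

theorem equivalent_iff (f f' : PartialHom G H) :
    f.Equivalent f' ↔ ∃ K : AddSubgroup G, K.FiniteIndex ∧ f.AgreeOn f' K := by
  have hd := (f - f').finiteIndex
  constructor
  · intro h
    have hr : Finite (f - f').toFun.range := h.to_subtype
    refine ⟨(f - f').toFun.ker.map (f - f').dom.subtype, ?_, ?_⟩
    · rw [AddSubgroup.finiteIndex_iff, AddSubgroup.index_map_subtype]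
      exact mul_ne_zero AddSubgroup.FiniteIndex.index_ne_zero hd.index_ne_zero
    · rintro _ ⟨x, hx, rfl⟩
      refine ⟨x.2.1, x.2.2, ?_⟩
      have hx' : f.toFun ⟨x, x.2.1⟩ + -f'.toFun ⟨x, x.2.2⟩ = 0 := hx
      exact add_neg_eq_zero.1 hx'
  · rintro ⟨K, hK, h⟩
    have hle : K.addSubgroupOf (f - f').dom ≤ (f - f').toFun.ker := by
      intro x hx
      obtain ⟨h1, h2, h3⟩ := h x.1 hx
      change f.toFun ⟨x, h1⟩ + -f'.toFun ⟨x, h2⟩ = 0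
      rw [h3, add_neg_cancel]
    have hker : (f - f').toFun.ker.FiniteIndex := AddSubgroup.finiteIndex_of_le hle
    have : Finite (f - f').toFun.range :=
      Finite.of_equiv _ (QuotientAddGroup.quotientKerEquivRange (f - f').toFun).toEquiv
    exact Set.finite_coe_iff.1 this

theorem AgreeOn.equivalent {f f' : PartialHom G H} {K : AddSubgroup G} (hK : K.FiniteIndex)
    (h : f.AgreeOn f' K) : f.Equivalent f' :=
  (equivalent_iff f f').2 ⟨K, hK, h⟩

/-- The relation `∼` as an equivalence relation. -/
instance setoid (G H : Type*) [AddCommGroup G] [AddCommGroup H] : Setoid (PartialHom G H) where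
  r := Equivalent
  iseqv :=
    { refl := fun f => AgreeOn.equivalent f.finiteIndex fun _ hx => ⟨hx, hx, rfl⟩
      symm := fun {f f'} h => by
        obtain ⟨K, hK, h⟩ := (equivalent_iff _ _).1 h
        exact AgreeOn.equivalent hK fun x hx =>
          let ⟨h1, h2, h3⟩ := h x hx
          ⟨h2, h1, h3.symm⟩
      trans := fun {f f' f''} h h' => by
        obtain ⟨K, hK, h⟩ := (equivalent_iff _ _).1 h
        obtain ⟨K', hK', h'⟩ := (equivalent_iff _ _).1 h'
        exact AgreeOn.equivalent (K := K ⊓ K') inferInstance fun x hx =>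
          let ⟨h1, _, h3⟩ := h x hx.1
          let ⟨_, h5, h6⟩ := h' x hx.2
          ⟨h1, h5, h3.trans h6⟩ }

end PartialHom

open PartialHom in
/-- The group of partial homomorphisms modulo `∼`. For a Lie ring and a module this is the group of
almost `1`-cochains. -/
def PHomClass (G H : Type*) [AddCommGroup G] [AddCommGroup H] : Type _ :=
  Quotient (PartialHom.setoid G H)

namespace PHomClass

variable {G H : Type*} [AddCommGroup G] [AddCommGroup H]

/-- The class of a partial homomorphism. -/
def mk (f : PartialHom G H) : PHomClass G H := Quotient.mk _ f

theorem mk_eq_iff {f f' : PartialHom G H} : mk f = mk f' ↔ f.Equivalent f' := Quotient.eq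

theorem mk_eq {f f' : PartialHom G H} {K : AddSubgroup G} (hK : K.FiniteIndex)
    (h : f.AgreeOn f' K) : mk f = mk f' :=
  mk_eq_iff.2 (h.equivalent hK)

instance : Zero (PHomClass G H) := ⟨mk 0⟩

instance : Add (PHomClass G H) :=
  ⟨Quotient.map₂ (· + ·) fun f f' h g g' h' => by
    obtain ⟨K, hK, h⟩ := (PartialHom.equivalent_iff _ _).1 h
    obtain ⟨K', hK', h'⟩ := (PartialHom.equivalent_iff _ _).1 h'
    refine PartialHom.AgreeOn.equivalent (K := K ⊓ K') inferInstance fun x hx => ?_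
    obtain ⟨h1, h2, h3⟩ := h x hx.1
    obtain ⟨h4, h5, h6⟩ := h' x hx.2
    exact ⟨⟨h1, h4⟩, ⟨h2, h5⟩, congrArg₂ (· + ·) h3 h6⟩⟩

instance : Neg (PHomClass G H) :=
  ⟨Quotient.map (- ·) fun f f' h => by
    obtain ⟨K, hK, h⟩ := (PartialHom.equivalent_iff _ _).1 h
    refine PartialHom.AgreeOn.equivalent hK fun x hx => ?_
    obtain ⟨h1, h2, h3⟩ := h x hx
    exact ⟨h1, h2, congrArg (- ·) h3⟩⟩

theorem mk_add (f f' : PartialHom G H) : mk (f + f') = mk f + mk f' := rfl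

theorem mk_neg (f : PartialHom G H) : mk (-f) = -mk f := rfl

instance : AddCommGroup (PHomClass G H) where
  add_assoc a b c := by
    induction a, b, c using Quotient.inductionOn₃ with | _ f g h
    exact mk_eq ((f + g) + h).finiteIndex fun x hx =>
      ⟨hx, ⟨hx.1.1, hx.1.2, hx.2⟩, add_assoc (f.toFun ⟨x, hx.1.1⟩) (g.toFun ⟨x, hx.1.2⟩) _⟩
  zero_add a := by
    induction a using Quotient.inductionOn with | _ f
    exact mk_eq f.finiteIndex fun x hx => ⟨⟨trivial, hx⟩, hx, zero_add _⟩
  add_zero a := by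
    induction a using Quotient.inductionOn with | _ f
    exact mk_eq f.finiteIndex fun x hx => ⟨⟨hx, trivial⟩, hx, add_zero _⟩
  add_comm a b := by
    induction a, b using Quotient.inductionOn₂ with | _ f g
    exact mk_eq (f + g).finiteIndex fun x hx =>
      ⟨hx, ⟨hx.2, hx.1⟩, add_comm (f.toFun ⟨x, hx.1⟩) (g.toFun ⟨x, hx.2⟩)⟩
  neg_add_cancel a := by
    induction a using Quotient.inductionOn with | _ f
    exact mk_eq f.finiteIndex fun x hx =>
      ⟨⟨hx, hx⟩, trivial, neg_add_cancel (f.toFun ⟨x, hx⟩)⟩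
  nsmul := nsmulRec
  zsmul := zsmulRec

end PHomClass

/-! ## Almost derivations and the first almost cohomology group -/

section Cohomology

variable {𝔤 A : Type*} [LieRing 𝔤] [AddCommGroup A] [LieRingModule 𝔤 A]

namespace PartialHom

/-- For `g` in the domain of `f`, the subgroup of all `x` in the domain of `f` such that `⁅g, x⁆` is
in the domain of `f` and the derivation identity holds for `g` and `x`. -/
def derivAt (f : PartialHom 𝔤 A) (g : f.dom) : AddSubgroup 𝔤 where
  carrier := {x | ∃ (hx : x ∈ f.dom) (hgx : ⁅(g : 𝔤), x⁆ ∈ f.dom),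
    f.toFun ⟨⁅(g : 𝔤), x⁆, hgx⟩ = ⁅(g : 𝔤), f.toFun ⟨x, hx⟩⁆ - ⁅x, f.toFun g⁆}
  zero_mem' := by
    refine ⟨zero_mem _, by simp, ?_⟩
    have h : (⟨⁅(g : 𝔤), (0 : 𝔤)⁆, by simp⟩ : f.dom) = 0 := Subtype.ext (lie_zero _)
    have h0 : (⟨0, zero_mem _⟩ : f.dom) = 0 := rfl
    rw [h, h0]
    simp
  add_mem' := by
    rintro x y ⟨hx, hgx, ex⟩ ⟨hy, hgy, ey⟩
    have hgxy : ⁅(g : 𝔤), x + y⁆ ∈ f.dom := by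
      rw [lie_add]
      exact add_mem hgx hgy
    refine ⟨add_mem hx hy, hgxy, ?_⟩
    have h : (⟨⁅(g : 𝔤), x + y⁆, hgxy⟩ : f.dom) = ⟨_, hgx⟩ + ⟨_, hgy⟩ :=
      Subtype.ext (lie_add _ _ _)
    have h0 : (⟨x + y, add_mem hx hy⟩ : f.dom) = ⟨x, hx⟩ + ⟨y, hy⟩ := rfl
    rw [h, h0, map_add, map_add, lie_add, add_lie, ex, ey]
    abel
  neg_mem' := by
    rintro x ⟨hx, hgx, ex⟩
    have hgx' : ⁅(g : 𝔤), -x⁆ ∈ f.dom := by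
      rw [lie_neg]
      exact neg_mem hgx
    refine ⟨neg_mem hx, hgx', ?_⟩
    have h : (⟨⁅(g : 𝔤), -x⁆, hgx'⟩ : f.dom) = -⟨_, hgx⟩ := Subtype.ext (lie_neg _ _)
    have h0 : (⟨-x, neg_mem hx⟩ : f.dom) = -⟨x, hx⟩ := rfl
    rw [h, h0, map_neg, map_neg, lie_neg, neg_lie, ex]
    abel

/-- The subgroup of all `g` in the domain of `f` such that `f.derivAt g` is commensurable to the
whole Lie ring, that is, of finite index. -/
def derivDom (f : PartialHom 𝔤 A) : AddSubgroup 𝔤 where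
  carrier := {g | ∃ hg : g ∈ f.dom, (f.derivAt ⟨g, hg⟩).FiniteIndex}
  zero_mem' := by
    refine ⟨zero_mem _, ?_⟩
    have := f.finiteIndex
    refine AddSubgroup.finiteIndex_of_le (H := f.dom) fun x hx => ⟨hx, by simp, ?_⟩
    have h : (⟨⁅(0 : 𝔤), x⁆, by simp⟩ : f.dom) = 0 := Subtype.ext (zero_lie _)
    have h0 : (⟨0, zero_mem _⟩ : f.dom) = 0 := rfl
    rw [h, h0]
    simp
  add_mem' := by
    rintro a b ⟨ha, hfa⟩ ⟨hb, hfb⟩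
    refine ⟨add_mem ha hb, ?_⟩
    refine AddSubgroup.finiteIndex_of_le (H := f.derivAt ⟨a, ha⟩ ⊓ f.derivAt ⟨b, hb⟩) ?_
    rintro x ⟨⟨hx, hax, ea⟩, ⟨_, hbx, eb⟩⟩
    have hab : ⁅a + b, x⁆ ∈ f.dom := by
      rw [add_lie]
      exact add_mem hax hbx
    refine ⟨hx, hab, ?_⟩
    have h : (⟨⁅a + b, x⁆, hab⟩ : f.dom) = ⟨_, hax⟩ + ⟨_, hbx⟩ := Subtype.ext (add_lie _ _ _)
    have h0 : (⟨a + b, add_mem ha hb⟩ : f.dom) = ⟨a, ha⟩ + ⟨b, hb⟩ := rfl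
    rw [h, h0, map_add, map_add, lie_add, ea, eb]
    change _ = ⁅a + b, _⁆ - _
    rw [add_lie]
    abel
  neg_mem' := by
    rintro a ⟨ha, hfa⟩
    refine ⟨neg_mem ha, ?_⟩
    refine AddSubgroup.finiteIndex_of_le (H := f.derivAt ⟨a, ha⟩) ?_
    rintro x ⟨hx, hax, ea⟩
    have hna : ⁅-a, x⁆ ∈ f.dom := by
      rw [neg_lie]
      exact neg_mem hax
    refine ⟨hx, hna, ?_⟩
    have h : (⟨⁅-a, x⁆, hna⟩ : f.dom) = -⟨_, hax⟩ := Subtype.ext (neg_lie _ _)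
    have h0 : (⟨-a, neg_mem ha⟩ : f.dom) = -⟨a, ha⟩ := rfl
    rw [h, h0, map_neg, map_neg, lie_neg, ea]
    change _ = ⁅-a, _⁆ - _
    rw [neg_lie]
    abel

/-- `f` is an almost derivation. -/
def IsAlmostDerivation (f : PartialHom 𝔤 A) : Prop := f.derivDom.FiniteIndex

theorem finiteIndex_comap {G G' : Type*} [AddCommGroup G] [AddCommGroup G'] (φ : G →+ G')
    {K : AddSubgroup G'} (hK : K.FiniteIndex) : (K.comap φ).FiniteIndex := by
  rw [AddSubgroup.finiteIndex_iff, AddSubgroup.index_comap]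
  exact fun h => hK.index_ne_zero (Nat.eq_zero_of_zero_dvd (h ▸ AddSubgroup.relIndex_dvd_index_of_normal K _))

theorem IsAlmostDerivation.add {f f' : PartialHom 𝔤 A} (hf : f.IsAlmostDerivation)
    (hf' : f'.IsAlmostDerivation) : (f + f').IsAlmostDerivation := by
  have := show f.derivDom.FiniteIndex from hf
  have := show f'.derivDom.FiniteIndex from hf'
  refine AddSubgroup.finiteIndex_of_le (H := f.derivDom ⊓ f'.derivDom) ?_
  rintro g ⟨⟨hg, h⟩, ⟨hg', h'⟩⟩
  refine ⟨⟨hg, hg'⟩, ?_⟩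
  refine AddSubgroup.finiteIndex_of_le (H := f.derivAt ⟨g, hg⟩ ⊓ f'.derivAt ⟨g, hg'⟩) ?_
  rintro x ⟨⟨hx, hgx, e⟩, ⟨hx', hgx', e'⟩⟩
  refine ⟨⟨hx, hx'⟩, ⟨hgx, hgx'⟩, ?_⟩
  change f.toFun ⟨_, hgx⟩ + f'.toFun ⟨_, hgx'⟩ =
    ⁅g, f.toFun ⟨x, hx⟩ + f'.toFun ⟨x, hx'⟩⁆ - ⁅x, f.toFun ⟨g, hg⟩ + f'.toFun ⟨g, hg'⟩⁆
  rw [e, e', lie_add, lie_add]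
  abel

theorem IsAlmostDerivation.neg {f : PartialHom 𝔤 A} (hf : f.IsAlmostDerivation) :
    (-f).IsAlmostDerivation := by
  have := show f.derivDom.FiniteIndex from hf
  refine AddSubgroup.finiteIndex_of_le (H := f.derivDom) ?_
  rintro g ⟨hg, h⟩
  refine ⟨hg, ?_⟩
  refine AddSubgroup.finiteIndex_of_le (H := f.derivAt ⟨g, hg⟩) ?_
  rintro x ⟨hx, hgx, e⟩
  refine ⟨hx, hgx, ?_⟩
  change -f.toFun ⟨_, hgx⟩ = ⁅g, -f.toFun ⟨x, hx⟩⁆ - ⁅x, -f.toFun ⟨g, hg⟩⁆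
  rw [e, lie_neg, lie_neg]
  abel

/-- The inner derivation `x ↦ x · a`. -/
def inner (𝔤 : Type*) [LieRing 𝔤] [LieRingModule 𝔤 A] (a : A) : PartialHom 𝔤 A where
  dom := ⊤
  finiteIndex := inferInstance
  toFun := (actRight 𝔤 a).comp (⊤ : AddSubgroup 𝔤).subtype

theorem inner_isAlmostDerivation (a : A) : (inner 𝔤 a).IsAlmostDerivation := by
  refine AddSubgroup.finiteIndex_of_le (H := ⊤) fun g _ => ⟨trivial, ?_⟩
  refine AddSubgroup.finiteIndex_of_le (H := ⊤) fun x _ => ⟨trivial, trivial, ?_⟩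
  exact lie_lie g x a

/-- The image of a partial homomorphism under `φ : 𝔤 → 𝔤'` on the domain and `ψ : A' → A` on the
values: the partial homomorphism `x ↦ ψ (f (φ x))` with domain `φ ⁻¹ (dom f)`. -/
def transport {G G' H H' : Type*} [AddCommGroup G] [AddCommGroup G'] [AddCommGroup H]
    [AddCommGroup H'] (φ : G →+ G') (ψ : H' →+ H) (f : PartialHom G' H') : PartialHom G H where
  dom := f.dom.comap φ
  finiteIndex := finiteIndex_comap φ f.finiteIndex
  toFun := ψ.comp (f.toFun.comp (φ.addSubgroupComap f.dom))

end PartialHom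

/-- The differential `A → PHomClass 𝔤 A`, sending `a` to the class of `x ↦ x · a`. -/
def differential (𝔤 A : Type*) [LieRing 𝔤] [AddCommGroup A] [LieRingModule 𝔤 A] :
    A →+ PHomClass 𝔤 A where
  toFun a := PHomClass.mk (PartialHom.inner 𝔤 a)
  map_zero' := PHomClass.mk_eq (K := ⊤) inferInstance fun x _ => ⟨trivial, trivial, lie_zero x⟩
  map_add' a b := PHomClass.mk_eq (K := ⊤) inferInstance fun x _ =>
    ⟨trivial, ⟨trivial, trivial⟩, lie_add x a b⟩

/-- The group of classes of almost derivations. -/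
def almDer (𝔤 A : Type*) [LieRing 𝔤] [AddCommGroup A] [LieRingModule 𝔤 A] :
    AddSubgroup (PHomClass 𝔤 A) where
  carrier := {c | ∃ f : PartialHom 𝔤 A, f.IsAlmostDerivation ∧ PHomClass.mk f = c}
  zero_mem' := ⟨PartialHom.inner 𝔤 0, PartialHom.inner_isAlmostDerivation 0,
    (differential 𝔤 A).map_zero⟩
  add_mem' := by
    rintro _ _ ⟨f, hf, rfl⟩ ⟨f', hf', rfl⟩
    exact ⟨f + f', hf.add hf', rfl⟩
  neg_mem' := by
    rintro _ ⟨f, hf, rfl⟩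
    exact ⟨-f, hf.neg, rfl⟩

/-- The first almost cohomology group: almost derivations modulo the image of the differential. -/
def AlmostH1 (𝔤 A : Type*) [LieRing 𝔤] [AddCommGroup A] [LieRingModule 𝔤 A] : Type _ :=
  almDer 𝔤 A ⧸ (differential 𝔤 A).range.addSubgroupOf (almDer 𝔤 A)

instance (𝔤 A : Type*) [LieRing 𝔤] [AddCommGroup A] [LieRingModule 𝔤 A] :
    AddCommGroup (AlmostH1 𝔤 A) :=
  inferInstanceAs (AddCommGroup (_ ⧸ (differential 𝔤 A).range.addSubgroupOf (almDer 𝔤 A)))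

/-- The class in `AlmostH1 𝔤 A` of an almost derivation. -/
def AlmostH1.mk (f : PartialHom 𝔤 A) (hf : f.IsAlmostDerivation) : AlmostH1 𝔤 A :=
  QuotientAddGroup.mk (⟨PHomClass.mk f, f, hf, rfl⟩ : almDer 𝔤 A)

section Functoriality

variable {𝔤' A' : Type*} [LieRing 𝔤'] [AddCommGroup A'] [LieRingModule 𝔤' A']

/-- The map on classes of partial homomorphisms that is induced by `PartialHom.transport`. -/
def PHomClass.transport {G G' H H' : Type*} [AddCommGroup G] [AddCommGroup G'] [AddCommGroup H]
    [AddCommGroup H'] (φ : G →+ G') (ψ : H' →+ H) : PHomClass G' H' →+ PHomClass G H where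
  toFun := Quotient.map (PartialHom.transport φ ψ) fun f f' h => by
    obtain ⟨K, hK, h⟩ := (PartialHom.equivalent_iff _ _).1 h
    refine PartialHom.AgreeOn.equivalent (PartialHom.finiteIndex_comap φ hK) fun x hx => ?_
    obtain ⟨h1, h2, h3⟩ := h (φ x) hx
    exact ⟨h1, h2, congrArg ψ h3⟩
  map_zero' := PHomClass.mk_eq (K := ⊤) inferInstance fun _ _ => ⟨trivial, trivial, map_zero ψ⟩
  map_add' a b := by
    induction a, b using Quotient.inductionOn₂ with | _ f g
    exact PHomClass.mk_eq (PartialHom.transport φ ψ (f + g)).finiteIndex fun x hx =>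
      ⟨hx, ⟨hx.1, hx.2⟩, map_add ψ (f.toFun ⟨φ x, hx.1⟩) (g.toFun ⟨φ x, hx.2⟩)⟩

theorem PartialHom.IsAlmostDerivation.transport {f : PartialHom 𝔤' A'}
    (hf : f.IsAlmostDerivation) (φ : 𝔤 →ₗ⁅ℤ⁆ 𝔤') (ψ : A' →+ A)
    (hψ : ∀ (x : 𝔤) (a : A'), ψ ⁅φ x, a⁆ = ⁅x, ψ a⁆) :
    (f.transport (φ : 𝔤 →+ 𝔤') ψ).IsAlmostDerivation := by
  have := finiteIndex_comap (φ : 𝔤 →+ 𝔤') (show f.derivDom.FiniteIndex from hf)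
  refine AddSubgroup.finiteIndex_of_le (H := f.derivDom.comap (φ : 𝔤 →+ 𝔤')) ?_
  rintro g ⟨hg, h⟩
  refine ⟨hg, ?_⟩
  have := finiteIndex_comap (φ : 𝔤 →+ 𝔤')
    (show (f.derivAt ⟨φ g, hg⟩).FiniteIndex from h)
  refine AddSubgroup.finiteIndex_of_le
    (H := (f.derivAt ⟨φ g, hg⟩).comap (φ : 𝔤 →+ 𝔤')) ?_
  rintro x ⟨hx, hgx, e⟩
  have hgx' : φ ⁅g, x⁆ ∈ f.dom := by
    rw [LieHom.map_lie]
    exact hgx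
  refine ⟨hx, hgx', ?_⟩
  change ψ (f.toFun ⟨φ ⁅g, x⁆, hgx'⟩) =
    ⁅g, ψ (f.toFun ⟨φ x, hx⟩)⁆ - ⁅x, ψ (f.toFun ⟨φ g, hg⟩)⁆
  have h : (⟨φ ⁅g, x⁆, hgx'⟩ : f.dom) = ⟨⁅φ g, φ x⁆, hgx⟩ := Subtype.ext (LieHom.map_lie _ _ _)
  rw [h, ← hψ, ← hψ, ← map_sub]
  exact congrArg ψ e

/-- The map `[f] ↦ [ψ ∘ f ∘ φ]` on first almost cohomology groups, for a homomorphism of Lie rings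
`φ : 𝔤 → 𝔤'` and a homomorphism of groups `ψ : A' → A` that is `𝔤`-equivariant. -/
def AlmostH1.map (φ : 𝔤 →ₗ⁅ℤ⁆ 𝔤') (ψ : A' →+ A)
    (hψ : ∀ (x : 𝔤) (a : A'), ψ ⁅φ x, a⁆ = ⁅x, ψ a⁆) : AlmostH1 𝔤' A' →+ AlmostH1 𝔤 A :=
  QuotientAddGroup.map _ _
    (((PHomClass.transport (φ : 𝔤 →+ 𝔤') ψ).comp (almDer 𝔤' A').subtype).codRestrict (almDer 𝔤 A)
      (by
        rintro ⟨_, f, hf, rfl⟩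
        exact ⟨_, hf.transport φ ψ hψ, rfl⟩))
    (by
      rintro ⟨_, _⟩ ⟨a, rfl⟩
      exact ⟨ψ a, PHomClass.mk_eq (K := ⊤) inferInstance
        fun x _ => ⟨trivial, trivial, (hψ x a).symm⟩⟩)

theorem AlmostH1.map_mk (φ : 𝔤 →ₗ⁅ℤ⁆ 𝔤') (ψ : A' →+ A)
    (hψ : ∀ (x : 𝔤) (a : A'), ψ ⁅φ x, a⁆ = ⁅x, ψ a⁆) (f : PartialHom 𝔤' A')
    (hf : f.IsAlmostDerivation) :
    AlmostH1.map φ ψ hψ (AlmostH1.mk f hf) =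
      AlmostH1.mk (f.transport (φ : 𝔤 →+ 𝔤') ψ) (hf.transport φ ψ hψ) :=
  rfl

end Functoriality

/-- The natural projection to the quotient by an ideal. -/
def quotientHom (I : LieIdeal ℤ 𝔤) : 𝔤 →ₗ⁅ℤ⁆ 𝔤 ⧸ I :=
  { I.toSubmodule.mkQ with map_lie' := rfl }

/-- Restriction to an ideal: `[f] ↦ [f restricted to 𝔥 ∩ dom f]`. -/
def restriction (A : Type*) [AddCommGroup A] [LieRingModule 𝔤 A] (𝔥 : LieIdeal ℤ 𝔤) :
    AlmostH1 𝔤 A →+ AlmostH1 𝔥 A :=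
  AlmostH1.map 𝔥.incl (AddMonoidHom.id A) fun _ _ => rfl

/-- The map on first almost cohomology groups that is induced by the inclusion of a submodule. -/
def inclH1 (B : LieSubmodule ℤ 𝔤 A) : AlmostH1 𝔤 B →+ AlmostH1 𝔤 A :=
  AlmostH1.map LieHom.id B.toSubmodule.subtype.toAddMonoidHom fun _ _ => rfl

/-- Inflation: for an ideal `I` that acts trivially on the submodule `B`, the class of `f` goes to
the class of `x ↦ f (x + I)`. -/
def inflation (I : LieIdeal ℤ 𝔤) (B : LieSubmodule ℤ 𝔤 A) (h : ∀ x ∈ I, ∀ b ∈ B, ⁅x, b⁆ = 0) :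
    letI := quotientModule I B h
    AlmostH1 (𝔤 ⧸ I) B →+ AlmostH1 𝔤 B :=
  letI := quotientModule I B h
  AlmostH1.map (quotientHom I) (AddMonoidHom.id B) fun _ _ => rfl

/-- Inflation followed by the map that is induced by the inclusion of `B` in `A`. -/
def inflation' (I : LieIdeal ℤ 𝔤) (B : LieSubmodule ℤ 𝔤 A) (h : ∀ x ∈ I, ∀ b ∈ B, ⁅x, b⁆ = 0) :
    letI := quotientModule I B h
    AlmostH1 (𝔤 ⧸ I) B →+ AlmostH1 𝔤 A :=
  letI := quotientModule I B h
  (inclH1 B).comp (inflation I B h)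

end Cohomology

end AlmCoh

/-! Write `B` for the almost centraliser of `𝔥` in `A` and `𝔥₁` for that of `B` in `𝔥`. Finite
dimension enters once, in `exists_card_orbit_bound`: the finite orbits `𝔥 · a` have bounded size.
Otherwise the annihilators in `𝔥` of suitable tuples form chains of any length with all successive
indices as large as desired. In an ultrapower these indices become infinite, so the dimension of `𝔥`
exceeds every natural number.

The bound makes almost centralising symmetric and uniform. By pigeonhole and Neumann's covering
lemma, `𝔥₁` has finite index in `𝔥` (`relIndex_ne_zero_of_orbit_bound`). An orbit of maximal size
shows that the set of products `𝔥₁ · B` is finite (`finite_lie_of_orbit_bound`). As `g(xa) = [g,x]a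
+ x(ga)`, each product `xa` then has a finite orbit under `𝔤`, so it is `0` by hypothesis: `𝔥₁`
annihilates `B`.

The rest is inflation-restriction up to finite index. Let the class of `f` restrict to `0`. After
subtraction of an inner derivation, `f` vanishes on almost all of `𝔥`. For `g` in `D^f` and almost
all `x ∈ 𝔥` the derivation identity reads `0 = -x f(g)`, so `f(g) ∈ B`. For `x ∈ 𝔥₁ ∩ D^f` and
almost all `y ∈ 𝔤` it reads `f([x,y]) = -y f(x)`. The left side takes finitely many values, so
`f(x)` has a finite orbit and is `0`. Hence `f` descends to a map from `𝔤 ⧸ 𝔥₁` to `B`. -/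

namespace AlmCoh

/-! ### Basic properties of the dimension, and formulas with finitely many parameters -/

section Dimension

variable {L : FirstOrder.Language.{u, v}}

namespace InterpretableSet

variable {M : Type w} [L.Structure M] {n : ℕ}

/-- The points of a definable subset. -/
noncomputable def restrictEquiv (X : InterpretableSet L M n) (S : Set X.Points)
    (hS : X.IsDefinable S) : (X.restrict S hS).Points ≃ S :=
  Equiv.ofBijective
    (Quotient.lift (s := (X.restrict S hS).rel)
      (fun x => (⟨Quotient.mk X.rel ⟨x.1, x.2.choose_spec.2.choose⟩, by
        have h := x.2.choose_spec
        rw [h.2.choose_spec]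
        exact h.1⟩ : S))
      fun _ _ hxy => Subtype.ext (Quotient.sound (s := X.rel) hxy)) (by
    constructor
    · intro p p' h
      induction p using Quotient.inductionOn with | _ x
      induction p' using Quotient.inductionOn with | _ y
      exact Quotient.sound (s := (X.restrict S hS).rel)
        (Quotient.exact (s := X.rel) (congrArg Subtype.val h))
    · rintro ⟨p, hp⟩
      obtain ⟨x, rfl⟩ := Quotient.exists_rep p
      exact ⟨Quotient.mk (X.restrict S hS).rel ⟨x.1, _, hp, x.2, rfl⟩, rfl⟩)

/-- The projection to the quotient by a coarser equivalence relation is interpretable. -/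
theorem isInterpretableMap_map {W : Set (Fin n → M)} (hW : (Set.univ : Set M).Definable L W)
    (r s : Setoid W) (hrs : r ≤ s)
    (hr : (Set.univ : Set M).Definable L
      {v : Fin n ⊕ Fin n → M | ∃ x y : W, v = Sum.elim x.1 y.1 ∧ r x y})
    (hs : (Set.univ : Set M).Definable L
      {v : Fin n ⊕ Fin n → M | ∃ x y : W, v = Sum.elim x.1 y.1 ∧ s x y}) :
    IsInterpretableMap (⟨W, r, hW, hr⟩ : InterpretableSet L M n) ⟨W, s, hW, hs⟩
      (Quotient.map' (s₁ := r) (s₂ := s) id hrs) := by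
  unfold IsInterpretableMap
  refine (congr rfl (Set.ext fun v => ?_)).mp hs
  constructor
  · rintro ⟨x, y, rfl, hxy⟩
    exact ⟨Quotient.mk r x, ⟨x.2, rfl⟩, y.2, Quotient.sound (s := s) (s.symm hxy)⟩
  · rintro ⟨p, ⟨hx, rfl⟩, hy, h⟩
    exact ⟨⟨_, hx⟩, ⟨_, hy⟩, (Sum.elim_comp_inl_inr v).symm, s.symm (Quotient.exact (s := s) h)⟩

/-- A point is a fibre of the identity map, and fibres of interpretable maps are definable. -/
theorem isDefinable_singleton (X : InterpretableSet L M n) (p : X.Points) :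
    X.IsDefinable {p} := by
  have h := (isInterpretableMap_map X.definable_carrier X.rel X.rel le_rfl X.definable_rel
    X.definable_rel).fiber p
  convert h using 1
  ext q
  induction q using Quotient.inductionOn with | _ x
  rfl

end InterpretableSet

namespace Dimension

open InterpretableSet

variable {T : L.Theory} (d : Dimension.{u, v, w} T) (N : T.ModelType.{u, v, w}) {n : ℕ}

/-- Monotonicity comes from the union axiom: `S = {p} ∪ S` for a point `p` of `S`, and `{p}` has
dimension `0`. -/
theorem zero_le_dim_restrict (X : InterpretableSet L N n) (S : Set X.Points)
    (hS : X.IsDefinable S) (hne : S.Nonempty) : 0 ≤ d.dim N (X.restrict S hS) := by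
  obtain ⟨p, hp⟩ := hne
  have hp' := X.isDefinable_singleton p
  have h0 : d.dim N (X.restrict {p} hp') = 0 :=
    (d.algebraicity N _ ⟨(X.restrictEquiv _ hp').symm ⟨p, rfl⟩⟩).2
      (Finite.of_equiv _ (X.restrictEquiv _ hp').symm)
  have h := d.union N X {p} S hp' hS
  have e : {p} ∪ S = S := Set.union_eq_self_of_subset_left (Set.singleton_subset_iff.2 hp)
  simp only [e, h0] at h
  rw [h]
  exact le_max_left _ _

theorem one_le_dim_restrict (X : InterpretableSet L N n) (S : Set X.Points)
    (hS : X.IsDefinable S) (hinf : S.Infinite) : 1 ≤ d.dim N (X.restrict S hS) := by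
  have h := d.zero_le_dim_restrict N X S hS hinf.nonempty
  have : Infinite S := hinf.to_subtype
  have hi : Infinite (X.restrict S hS).Points :=
    Infinite.of_injective _ (X.restrictEquiv S hS).symm.injective
  have h0 : d.dim N (X.restrict S hS) ≠ 0 := fun h0 =>
    not_finite_iff_infinite.2 hi ((d.algebraicity N _ inferInstance).1 h0)
  revert h h0
  generalize d.dim N (X.restrict S hS) = e
  induction e using WithBot.recBotCoe with
  | bot => simp
  | coe e =>
    intro _ h0
    have : e ≠ 0 := fun h => h0 (by rw [h]; rfl)
    exact WithBot.coe_le_coe.2 (Nat.one_le_iff_ne_zero.2 this)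

end Dimension

/-- Finitely many parameters suffice to define two definable sets. -/
theorem exists_formula_pair {M : Type w} [L.Structure M] {α β : Type*} {S : Set (α → M)}
    {S' : Set (β → M)} (hS : (Set.univ : Set M).Definable L S)
    (hS' : (Set.univ : Set M).Definable L S') :
    ∃ (p : ℕ) (a : Fin p → M) (φ : L.Formula (α ⊕ Fin p)) (ψ : L.Formula (β ⊕ Fin p)),
      (∀ v, v ∈ S ↔ φ.Realize (Sum.elim v a)) ∧ ∀ v, v ∈ S' ↔ ψ.Realize (Sum.elim v a) := by
  classical
  obtain ⟨P, -, hP⟩ := Set.definable_iff_finitely_definable.1 hS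
  obtain ⟨P', -, hP'⟩ := Set.definable_iff_finitely_definable.1 hS'
  obtain ⟨φ, hφ⟩ := Set.definable_iff_exists_formula_sum.1
    (hP.mono (Finset.coe_subset.2 (Finset.subset_union_left (s₂ := P'))))
  obtain ⟨ψ, hψ⟩ := Set.definable_iff_exists_formula_sum.1
    (hP'.mono (Finset.coe_subset.2 (Finset.subset_union_right (s₁ := P))))
  -- Numbering the union lets both formulas use the same tuple of parameters.
  let e := (P ∪ P').equivFin
  refine ⟨_, fun i => (e.symm i).1, φ.relabel (Sum.elim (fun x => Sum.inr (e x)) Sum.inl),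
    ψ.relabel (Sum.elim (fun x => Sum.inr (e x)) Sum.inl), fun v => ?_, fun v => ?_⟩
  · rw [hφ, Set.mem_ofPred_eq, FirstOrder.Language.Formula.realize_relabel]
    refine iff_of_eq (congrArg _ (funext ?_))
    rintro (x | x) <;> simp
  · rw [hψ, Set.mem_ofPred_eq, FirstOrder.Language.Formula.realize_relabel]
    refine iff_of_eq (congrArg _ (funext ?_))
    rintro (x | x) <;> simp

theorem definable_realize {M : Type w} [L.Structure M] {α : Type*} {p : ℕ}
    (φ : L.Formula (α ⊕ Fin p)) (a : Fin p → M) :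
    (Set.univ : Set M).Definable L {v : α → M | φ.Realize (Sum.elim v a)} := by
  refine Set.definable_iff_exists_formula_sum.2
    ⟨φ.relabel (Sum.elim Sum.inr fun i => Sum.inl ⟨a i, trivial⟩), Set.ext fun v => ?_⟩
  rw [Set.mem_ofPred_eq, Set.mem_ofPred_eq, FirstOrder.Language.Formula.realize_relabel]
  refine iff_of_eq (congrArg _ (funext ?_))
  rintro (x | x) <;> rfl

end Dimension
-- Chains of definable equivalence relations, and the ultrapower
section Dimension

variable {L : FirstOrder.Language.{u, v}} {T : L.Theory}

namespace Dimension

open InterpretableSet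

variable (d : Dimension.{u, v, w} T) (N : T.ModelType.{u, v, w}) {n : ℕ}

/-- The fibres of the projection are nonempty, so the fibration inequality applies with `k = 0`. -/
theorem dim_le_of_le {W : Set (Fin n → N)} (hW : (Set.univ : Set N).Definable L W)
    (r s : Setoid W) (hrs : r ≤ s)
    (hr : (Set.univ : Set N).Definable L
      {v : Fin n ⊕ Fin n → N | ∃ x y : W, v = Sum.elim x.1 y.1 ∧ r x y})
    (hs : (Set.univ : Set N).Definable L
      {v : Fin n ⊕ Fin n → N | ∃ x y : W, v = Sum.elim x.1 y.1 ∧ s x y}) :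
    d.dim N ⟨W, s, hW, hs⟩ ≤ d.dim N ⟨W, r, hW, hr⟩ := by
  have h := d.upper_fibration N ⟨W, r, hW, hr⟩ ⟨W, s, hW, hs⟩ _
    (isInterpretableMap_map hW r s hrs hr hs) 0 fun y => d.zero_le_dim_restrict N _ _ _ (by
      induction y using Quotient.inductionOn with | _ y
      exact ⟨Quotient.mk r y, rfl⟩)
  simpa using h

/-- By `hinf` each `s`-class contains infinitely many `r`-classes, so the fibres of the projection
have dimension at least `1`. -/
theorem dim_add_one_le {W : Set (Fin n → N)} (hW : (Set.univ : Set N).Definable L W)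
    (r s : Setoid W) (hrs : r ≤ s)
    (hr : (Set.univ : Set N).Definable L
      {v : Fin n ⊕ Fin n → N | ∃ x y : W, v = Sum.elim x.1 y.1 ∧ r x y})
    (hs : (Set.univ : Set N).Definable L
      {v : Fin n ⊕ Fin n → N | ∃ x y : W, v = Sum.elim x.1 y.1 ∧ s x y})
    (hinf : ∀ x, ∃ y : ℕ → W, (∀ l, s x (y l)) ∧ ∀ l l', r (y l) (y l') → l = l') :
    d.dim N ⟨W, s, hW, hs⟩ + 1 ≤ d.dim N ⟨W, r, hW, hr⟩ := by
  have h := d.upper_fibration N ⟨W, r, hW, hr⟩ ⟨W, s, hW, hs⟩ _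
    (isInterpretableMap_map hW r s hrs hr hs) 1 fun y => d.one_le_dim_restrict N _ _ _ (by
      induction y using Quotient.inductionOn with | _ x
      obtain ⟨y, hy, hy'⟩ := hinf x
      refine Set.infinite_of_injective_forall_mem (f := fun l => Quotient.mk r (y l))
        (fun l l' h => hy' l l' (Quotient.exact (s := r) h)) fun l => ?_
      exact Quotient.sound (s := s) (s.symm (hy l)))
  simpa using h

/-- A chain of `k` definable equivalence relations, each of which splits all classes of the
previous one into infinitely many classes, forces the dimension to be at least `k`. -/
theorem le_dim_of_chain {W : Set (Fin n → N)} (hW : (Set.univ : Set N).Definable L W)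
    (hne : W.Nonempty) (E : ℕ → Setoid W) (hE0 : E 0 = ⊤) (hE : ∀ i, E (i + 1) ≤ E i)
    (hdef : ∀ i, (Set.univ : Set N).Definable L
      {v : Fin n ⊕ Fin n → N | ∃ x y : W, v = Sum.elim x.1 y.1 ∧ E i x y}) (k : ℕ)
    (hinf : ∀ i < k, ∀ x, ∃ y : ℕ → W, (∀ l, E i x (y l)) ∧
      ∀ l l', E (i + 1) (y l) (y l') → l = l') :
    (k : WithBot ℕ) ≤ d.dim N ⟨W, E k, hW, hdef k⟩ := by
  induction k with
  | zero =>
    have : Subsingleton (InterpretableSet.mk W (E 0) hW (hdef 0)).Points := by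
      refine ⟨fun p p' => ?_⟩
      induction p using Quotient.inductionOn with | _ x
      induction p' using Quotient.inductionOn with | _ y
      refine Quotient.sound (s := E 0) ?_
      change E 0 x y
      rw [hE0]
      trivial
    have hp : Nonempty (InterpretableSet.mk W (E 0) hW (hdef 0)).Points :=
      hne.to_subtype.map (Quotient.mk (E 0))
    exact ((d.algebraicity N _ hp).2 inferInstance).ge
  | succ k ih =>
    refine le_trans ?_ (d.dim_add_one_le N hW (E (k + 1)) (E k) (hE k) (hdef _) (hdef _)
      (hinf k (Nat.lt_succ_self k)))
    rw [Nat.cast_add, Nat.cast_one]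
    exact add_le_add_left (ih fun i hi => hinf i (hi.trans (Nat.lt_succ_self k))) 1

end Dimension

/-- The ultrapower of a model over the natural numbers. -/
noncomputable def ultrapower (M : T.ModelType.{u, v, w}) : T.ModelType.{u, v, w} :=
  haveI : ((Filter.hyperfilter ℕ : Ultrafilter ℕ) : Filter ℕ).Product (fun _ => (M : Type w)) ⊨ T :=
    ⟨fun φ hφ => (FirstOrder.Language.Ultraproduct.sentence_realize φ).2
      (Filter.Eventually.of_forall fun _ => T.realize_sentence_of_mem hφ)⟩
  haveI : Nonempty (((Filter.hyperfilter ℕ : Ultrafilter ℕ) : Filter ℕ).Product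
      (fun _ => (M : Type w))) := FirstOrder.Language.Ultraproduct.Product.instNonempty
  FirstOrder.Language.Theory.ModelType.of T
    (((Filter.hyperfilter ℕ : Ultrafilter ℕ) : Filter ℕ).Product (fun _ => (M : Type w)))

/-- The tuple of the ultrapower that is represented by a sequence of tuples. -/
noncomputable def ultrapowerMk {M : T.ModelType.{u, v, w}} {α : Type*} (x : ℕ → α → M) :
    α → ultrapower M :=
  fun i => (Quotient.mk _ (fun t => x t i) :
    ((Filter.hyperfilter ℕ : Ultrafilter ℕ) : Filter ℕ).Product (fun _ => (M : Type w)))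

theorem ultrapowerMk_surjective {M : T.ModelType.{u, v, w}} {α : Type*} (x : α → ultrapower M) :
    ∃ y : ℕ → α → M, ultrapowerMk y = x := by
  have h : ∀ i, ∃ y : ℕ → M, Quotient.mk _ y = (x i : ((Filter.hyperfilter ℕ : Ultrafilter ℕ) :
      Filter ℕ).Product (fun _ => (M : Type w))) := fun i => Quotient.exists_rep _
  choose y hy using h
  exact ⟨fun t i => y i t, funext hy⟩

theorem ultrapowerMk_elim {M : T.ModelType.{u, v, w}} {α β : Type*} (x : ℕ → α → M)
    (y : ℕ → β → M) :
    Sum.elim (ultrapowerMk x) (ultrapowerMk y) = ultrapowerMk fun t => Sum.elim (x t) (y t) := by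
  funext i
  rcases i with i | i <;> rfl

/-- Łoś's theorem for tuples; with `ultrapowerMk_surjective` it reduces statements about the
ultrapower to statements that hold in almost all coordinates. -/
theorem realize_ultrapowerMk {M : T.ModelType.{u, v, w}} {α : Type*} (φ : L.Formula α)
    (x : ℕ → α → M) :
    φ.Realize (ultrapowerMk x) ↔
      ∀ᶠ t in ((Filter.hyperfilter ℕ : Ultrafilter ℕ) : Filter ℕ), φ.Realize (x t) :=
  FirstOrder.Language.Ultraproduct.realize_formula_cast φ fun i t => x t i

end Dimension
-- The chain condition
section Dimension

variable {L : FirstOrder.Language.{u, v}} {T : L.Theory}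

open FirstOrder Language in
/-- Equality of tuples, as a formula. -/
noncomputable def tupleEq (L : FirstOrder.Language.{u, v}) (n p : ℕ) :
    L.Formula ((Fin n ⊕ Fin n) ⊕ Fin p) :=
  BoundedFormula.iInf fun i : Fin n =>
    Term.equal (Term.var (Sum.inl (Sum.inl i))) (Term.var (Sum.inl (Sum.inr i)))

theorem realize_tupleEq {N : Type w} [L.Structure N] {n p : ℕ} (x y : Fin n → N)
    (a : Fin p → N) : (tupleEq L n p).Realize (Sum.elim (Sum.elim x y) a) ↔ x = y := by
  have := FirstOrder.Language.BoundedFormula.realize_iInf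
    (L := L) (M := N) (f := fun i : Fin n => FirstOrder.Language.Term.equal (L := L)
      (FirstOrder.Language.Term.var (Sum.inl (Sum.inl i)))
      (FirstOrder.Language.Term.var (Sum.inl (Sum.inr i) : (Fin n ⊕ Fin n) ⊕ Fin p)))
      (v := (Sum.elim (Sum.elim x y) a)) (v' := default)
  refine this.trans ⟨fun h => funext fun i => ?_, fun h i => ?_⟩
  · exact FirstOrder.Language.Formula.realize_equal.1 (h i)
  · exact FirstOrder.Language.Formula.realize_equal.2 (congrFun h i)

theorem definable_eq_rel {N : Type w} [L.Structure N] {n : ℕ} {W : Set (Fin n → N)}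
    (hW : (Set.univ : Set N).Definable L W) :
    (Set.univ : Set N).Definable L
      {v : Fin n ⊕ Fin n → N | ∃ x y : W, v = Sum.elim x.1 y.1 ∧ (⊥ : Setoid W) x y} := by
  refine (congr rfl (Set.ext fun v => ?_)).mp
    ((definable_realize (tupleEq L n 0) (Fin.elim0 : Fin 0 → N)).inter
      (hW.preimage_comp (Sum.inl : Fin n → Fin n ⊕ Fin n)))
  constructor
  · rintro ⟨h1, h2⟩
    have h : v ∘ Sum.inl = v ∘ Sum.inr := by
      rw [← realize_tupleEq (L := L) _ _ (Fin.elim0 : Fin 0 → N), Sum.elim_comp_inl_inr]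
      exact h1
    refine ⟨⟨_, h2⟩, ⟨_, h2⟩, ?_, rfl⟩
    conv_lhs => rw [← Sum.elim_comp_inl_inr v, ← h]
  · rintro ⟨x, y, rfl, rfl : x = y⟩
    refine ⟨(realize_tupleEq _ _ _).2 rfl, ?_⟩
    exact x.2

/-- The dimension of a definable set does not change in the ultrapower. -/
theorem Dimension.dim_ultrapower (d : Dimension.{u, v, w} T) (M : T.ModelType.{u, v, w})
    {n p : ℕ} (φ : L.Formula (Fin n ⊕ Fin p)) (a : Fin p → M) :
    d.dim (ultrapower M) ⟨_, ⊥, definable_realize φ (ultrapowerMk fun _ => a),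
        definable_eq_rel (definable_realize φ _)⟩ =
      d.dim M ⟨_, ⊥, definable_realize φ a, definable_eq_rel (definable_realize φ a)⟩ := by
  refine d.invariance _ _ φ (tupleEq L n p) (ultrapowerMk fun _ => a) a _ _ (fun ψ => ?_)
    ⟨fun x => Iff.rfl, fun x y => ?_⟩ ⟨fun x => Iff.rfl, fun x y => ?_⟩
  -- The diagonal embedding is elementary, so `a` and its image have the same type.
  · rw [realize_ultrapowerMk, Filter.eventually_const]
  · rw [realize_tupleEq]
    exact Subtype.ext_iff
  · rw [realize_tupleEq]
    exact Subtype.ext_iff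

/-- In a model of a finite-dimensional theory, there is a bound on the length and the width of
chains in a definable family of equivalence relations. -/
theorem exists_chain_bound (d : Dimension.{u, v, w} T) (M : T.ModelType.{u, v, w}) {n q : ℕ}
    {W : Set (Fin n → M)} (hW : (Set.univ : Set M).Definable L W) (hne : W.Nonempty)
    {R : Set ((Fin n ⊕ Fin n) ⊕ Fin q → M)} (hR : (Set.univ : Set M).Definable L R) :
    ∃ k m : ℕ, ∀ b : ℕ → Fin q → M,
      (∀ j, Equivalence fun x y : W => Sum.elim (Sum.elim x.1 y.1) (b j) ∈ R) →
      ∃ i < k, ∃ x ∈ W, ∀ y : ℕ → Fin n → M,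
        (∀ l, y l ∈ W ∧ ∀ j < i, Sum.elim (Sum.elim x (y l)) (b j) ∈ R) →
        ∃ l < m, ∃ l' < m, l ≠ l' ∧ Sum.elim (Sum.elim (y l) (y l')) (b i) ∈ R := by
  obtain ⟨p, a, φ, ρ, hφ, hρ⟩ := exists_formula_pair hW hR
  obtain rfl : W = {x | φ.Realize (Sum.elim x a)} := Set.ext hφ
  set W := {x | φ.Realize (Sum.elim x a)} with hWdef
  -- The length `k` is chosen beyond the dimension of `W`.
  obtain ⟨k, hk⟩ : ∃ k : ℕ, d.dim M ⟨W, ⊥, hW, definable_eq_rel hW⟩ < k := by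
    generalize d.dim M ⟨W, ⊥, hW, definable_eq_rel hW⟩ = e
    induction e using WithBot.recBotCoe with
    | bot => exact ⟨0, WithBot.bot_lt_coe 0⟩
    | coe e => exact ⟨e + 1, WithBot.coe_lt_coe.2 (Nat.lt_succ_self e)⟩
  refine ⟨k, ?_⟩
  -- For every width `t` there is then a chain `b t` in which each of the first `k` relations splits
  -- every class of its predecessors into at least `t` parts. Coordinate `t` of the ultrapower
  -- carries the chain of width `t`.
  by_contra! hcon
  choose b hbE hbW using hcon
  let a' : Fin p → ultrapower M := ultrapowerMk fun _ => a
  let b' : ℕ → Fin q → ultrapower M := fun j => ultrapowerMk fun t => b t j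
  let W' : Set (Fin n → ultrapower M) := {x | φ.Realize (Sum.elim x a')}
  have hmemW (x : ℕ → Fin n → M) : ultrapowerMk x ∈ W' ↔
      ∀ᶠ t in ((Filter.hyperfilter ℕ : Ultrafilter ℕ) : Filter ℕ), x t ∈ W := by
    change φ.Realize (Sum.elim (ultrapowerMk x) a') ↔ _
    rw [ultrapowerMk_elim, realize_ultrapowerMk]
    rfl
  let R' (j : ℕ) (x y : Fin n → ultrapower M) : Prop :=
    ρ.Realize (Sum.elim (Sum.elim (Sum.elim x y) (b' j)) a')
  have hmemR (j : ℕ) (x y : ℕ → Fin n → M) : R' j (ultrapowerMk x) (ultrapowerMk y) ↔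
      ∀ᶠ t in ((Filter.hyperfilter ℕ : Ultrafilter ℕ) : Filter ℕ),
        Sum.elim (Sum.elim (x t) (y t)) (b t j) ∈ R := by
    change ρ.Realize (Sum.elim (Sum.elim (Sum.elim (ultrapowerMk x) (ultrapowerMk y)) (b' j)) a')
      ↔ _
    rw [ultrapowerMk_elim, ultrapowerMk_elim, ultrapowerMk_elim, realize_ultrapowerMk]
    exact Filter.eventually_congr (Filter.Eventually.of_forall fun t => (hρ _).symm)
  have hequiv (j : ℕ) : Equivalence fun x y : W' => R' j x.1 y.1 := by
    refine ⟨?_, ?_, ?_⟩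
    · rintro ⟨x, hx⟩
      obtain ⟨x, rfl⟩ := ultrapowerMk_surjective x
      rw [hmemW] at hx
      refine (hmemR _ _ _).2 ?_
      filter_upwards [hx] with t hx
      exact (hbE t j).refl ⟨_, hx⟩
    · rintro ⟨x, hx⟩ ⟨y, hy⟩ h
      obtain ⟨x, rfl⟩ := ultrapowerMk_surjective x
      obtain ⟨y, rfl⟩ := ultrapowerMk_surjective y
      rw [hmemW] at hx hy
      replace h := (hmemR _ _ _).1 h
      refine (hmemR _ _ _).2 ?_
      filter_upwards [hx, hy, h] with t hx hy h
      exact (hbE t j).symm (x := ⟨_, hx⟩) (y := ⟨_, hy⟩) h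
    · rintro ⟨x, hx⟩ ⟨y, hy⟩ ⟨z, hz⟩ h h'
      obtain ⟨x, rfl⟩ := ultrapowerMk_surjective x
      obtain ⟨y, rfl⟩ := ultrapowerMk_surjective y
      obtain ⟨z, rfl⟩ := ultrapowerMk_surjective z
      rw [hmemW] at hx hy hz
      replace h := (hmemR _ _ _).1 h
      replace h' := (hmemR _ _ _).1 h'
      refine (hmemR _ _ _).2 ?_
      filter_upwards [hx, hy, hz, h, h'] with t hx hy hz h h'
      exact (hbE t j).trans (x := ⟨_, hx⟩) (y := ⟨_, hy⟩) (z := ⟨_, hz⟩) h h'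
  -- The conjunction of the first `i` relations; for `i = 0` it is the total relation.
  let E (i : ℕ) : Setoid W' :=
    { r := fun x y => ∀ j < i, R' j x.1 y.1
      iseqv := ⟨fun x j _ => (hequiv j).refl x, fun h j hj => (hequiv j).symm (h j hj),
        fun h h' j hj => (hequiv j).trans (h j hj) (h' j hj)⟩ }
  have hW' : (Set.univ : Set (ultrapower M)).Definable L W' := definable_realize φ a'
  have hdef (i : ℕ) : (Set.univ : Set (ultrapower M)).Definable L
      {v : Fin n ⊕ Fin n → ultrapower M | ∃ x y : W', v = Sum.elim x.1 y.1 ∧ E i x y} := by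
    have h1 (j : ℕ) : (Set.univ : Set (ultrapower M)).Definable L
        {v : Fin n ⊕ Fin n → ultrapower M | R' j (v ∘ Sum.inl) (v ∘ Sum.inr)} := by
      refine (congr rfl (Set.ext fun v => ?_)).mp (definable_realize (ρ.relabel
        (Sum.elim (Sum.elim Sum.inl (Sum.inr ∘ Fin.castAdd p)) (Sum.inr ∘ Fin.natAdd q)))
        (Fin.append (b' j) a'))
      change _ ↔ ρ.Realize _
      rw [Set.mem_ofPred_eq, FirstOrder.Language.Formula.realize_relabel]
      refine iff_of_eq (congrArg _ (funext ?_))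
      rintro (((x | x) | x) | x) <;> simp
    refine (congr rfl (Set.ext fun v => ?_)).mp
      (((hW'.preimage_comp (Sum.inl : Fin n → Fin n ⊕ Fin n)).inter
      (hW'.preimage_comp (Sum.inr : Fin n → Fin n ⊕ Fin n))).inter
        (Set.definable_iInter_of_finite fun j : Fin i => h1 j))
    constructor
    · rintro ⟨⟨hx, hy⟩, h⟩
      rw [Set.mem_iInter] at h
      exact ⟨⟨_, hx⟩, ⟨_, hy⟩, (Sum.elim_comp_inl_inr v).symm, fun j hj => h ⟨j, hj⟩⟩
    · rintro ⟨x, y, rfl, h⟩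
      exact ⟨⟨x.2, y.2⟩, Set.mem_iInter.2 fun j => h j j.2⟩
  have hle := d.le_dim_of_chain (ultrapower M) hW' (by
      obtain ⟨x, hx⟩ := hne
      exact ⟨ultrapowerMk fun _ => x, (hmemW _).2 (Filter.Eventually.of_forall fun _ => hx)⟩) E
    (by
      ext x y
      exact ⟨fun _ => trivial, fun _ j hj => absurd hj (Nat.not_lt_zero j)⟩)
    (fun i x y h j hj => h j (hj.trans (Nat.lt_succ_self i))) hdef k (by
      rintro i hi ⟨x, hx⟩
      obtain ⟨x, rfl⟩ := ultrapowerMk_surjective x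
      have hx' := (hmemW _).1 hx
      -- Coordinates with `x t ∉ W` are negligible for the ultrafilter, so any sequence will do
      -- there.
      have hy (t : ℕ) : ∃ y : ℕ → Fin n → M, x t ∈ W →
          (∀ l, y l ∈ W ∧ ∀ j < i, Sum.elim (Sum.elim (x t) (y l)) (b t j) ∈ R) ∧
          ∀ l < t, ∀ l' < t, l ≠ l' → Sum.elim (Sum.elim (y l) (y l')) (b t i) ∉ R := by
        by_cases h : x t ∈ W
        · obtain ⟨y, hy, hy'⟩ := hbW t i hi (x t) h
          exact ⟨y, fun _ => ⟨hy, hy'⟩⟩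
        · exact ⟨fun _ => x t, fun h' => absurd h' h⟩
      choose y hy using hy
      refine ⟨fun l => ⟨ultrapowerMk fun t => y t l, (hmemW _).2 ?_⟩, fun l j hj => ?_,
        fun l l' h => ?_⟩
      · filter_upwards [hx'] with t ht
        exact ((hy t ht).1 l).1
      · refine (hmemR _ _ _).2 ?_
        filter_upwards [hx'] with t ht
        exact ((hy t ht).1 l).2 j hj
      · by_contra hne
        have h := (hmemR _ _ _).1 (h i (Nat.lt_succ_self i))
        -- The ultrafilter is nonprincipal, so fixed indices `l`, `l'` lie below the width `t` in
        -- almost all coordinates. The whole sequence is therefore inequivalent and the splitting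
        -- infinite.
        have hgt : ∀ᶠ t in ((Filter.hyperfilter ℕ : Ultrafilter ℕ) : Filter ℕ),
            max l l' < t :=
          (Filter.Tendsto.eventually_gt_atTop Filter.tendsto_id (max l l')).filter_mono
            Nat.hyperfilter_le_atTop
        obtain ⟨t, ht, h, hgt⟩ := (hx'.and (h.and hgt)).exists
        exact (hy t ht).2 l ((le_max_left _ _).trans_lt hgt) l'
          ((le_max_right _ _).trans_lt hgt) hne h)
  -- The contradiction is `k ≤ dim (W' / E k) ≤ dim W' = dim W < k`.
  have hle' := d.dim_le_of_le (ultrapower M) hW' ⊥ (E k) bot_le (definable_eq_rel hW') (hdef k)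
  exact absurd ((hle.trans hle').trans_eq (d.dim_ultrapower M φ a)) hk.not_ge

end Dimension
-- The uniform bound on finite orbits
section Interpretation

variable {L : FirstOrder.Language.{u, v}} {M : Type w} [L.Structure M] {G : Type*}

theorem Interpretation.Codes.unique {I : Interpretation L M G} {x : Fin I.arity → M} {g g' : G}
    (h : I.Codes x g) (h' : I.Codes x g') : g = g' := by
  obtain ⟨_, h⟩ := h
  obtain ⟨_, h'⟩ := h'
  exact I.equiv.symm.injective (h.symm.trans h')

theorem Interpretation.exists_codes (I : Interpretation L M G) (g : G) : ∃ x, I.Codes x g := by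
  obtain ⟨x, hx⟩ := Quotient.exists_rep (I.equiv.symm g)
  exact ⟨x.1, x.2, hx⟩

variable {𝔤 A : Type*} [LieRing 𝔤] [AddCommGroup A] [LieRingModule 𝔤 A]

/-- The relation `x · a = y · a` between elements `x`, `y` of the ring and `a` of the module. -/
theorem DefinableModule.definable_lie_eq (D : DefinableModule L M 𝔤 A) :
    (Set.univ : Set M).Definable L
      {v : (Fin D.ring.arity ⊕ Fin D.ring.arity) ⊕ Fin D.group.arity → M | ∃ x y a,
        D.ring.Codes (v ∘ Sum.inl ∘ Sum.inl) x ∧ D.ring.Codes (v ∘ Sum.inl ∘ Sum.inr) y ∧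
          D.group.Codes (v ∘ Sum.inr) a ∧ ⁅x, a⁆ = ⁅y, a⁆} := by
  refine (congr rfl (Set.ext fun v => ?_)).mp
    -- The two graphs of the action share the coordinates that code the common value `x · a = y ·
    -- a`; these are then projected away.
    (((D.definable_action.preimage_comp (Sum.elim (Sum.elim (Sum.inl ∘ Sum.inl ∘ Sum.inl)
      (Sum.inl ∘ Sum.inr)) Sum.inr :
        _ → ((Fin D.ring.arity ⊕ Fin D.ring.arity) ⊕ Fin D.group.arity) ⊕ Fin D.group.arity)).inter
    (D.definable_action.preimage_comp (Sum.elim (Sum.elim (Sum.inl ∘ Sum.inl ∘ Sum.inr)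
      (Sum.inl ∘ Sum.inr)) Sum.inr))).image_comp Sum.inl)
  constructor
  · rintro ⟨v, ⟨⟨x, a, hx, ha, hc⟩, ⟨y, a', hy, ha', hc'⟩⟩, rfl⟩
    obtain rfl := ha.unique ha'
    exact ⟨x, y, a, hx, hy, ha, hc.unique hc'⟩
  · rintro ⟨x, y, a, hx, hy, ha, h⟩
    obtain ⟨c, hc⟩ := D.group.exists_codes ⁅x, a⁆
    exact ⟨Sum.elim v c, ⟨⟨x, a, hx, ha, hc⟩, ⟨y, a, hy, ha, by
      rw [h] at hc
      exact hc⟩⟩, rfl⟩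

end Interpretation

section Chain

variable {𝔤 A : Type*} [LieRing 𝔤] [AddCommGroup A] [LieRingModule 𝔤 A]

/-- If the finite orbits of `H` have unbounded size, then there are arbitrarily long and wide
chains of annihilators. -/
theorem exists_annihilator_chain (H : AddSubgroup 𝔤)
    (hunb : ∀ m : ℕ, ∃ a : A, (H.map (actRight 𝔤 a) : Set A).Finite ∧
      m < Nat.card (H.map (actRight 𝔤 a))) (m k : ℕ) :
    ∃ a : ℕ → A, (∀ j, (H.map (actRight 𝔤 (a j)) : Set A).Finite) ∧ ∀ i < k, ∃ z : ℕ → 𝔤,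
      (∀ l, z l ∈ H ∧ ∀ j < i, ⁅z l, a j⁆ = 0) ∧
        ∀ l < m, ∀ l' < m, ⁅z l, a i⁆ = ⁅z l', a i⁆ → l = l' := by
  induction k with
  | zero =>
    obtain ⟨a, ha, -⟩ := hunb 0
    exact ⟨fun _ => a, fun _ => ha, fun i hi => absurd hi (Nat.not_lt_zero i)⟩
  | succ k ih =>
    obtain ⟨a, hfin, ha⟩ := ih
    -- The kernel of `Φ` is the joint annihilator of the elements chosen so far. Their orbits are
    -- finite, so it meets `H` in a subgroup of finite index.
    let Φ : 𝔤 →+ (Fin k → A) := AddMonoidHom.pi fun j => actRight 𝔤 (a j)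
    have hΦ : Finite (H.map Φ) := by
      refine ((Set.Finite.pi' fun j : Fin k => hfin j).subset ?_).to_subtype
      rintro _ ⟨x, hx, rfl⟩ j
      exact ⟨x, hx, rfl⟩
    -- Passing from `H` to the joint annihilator shrinks the orbit of `b` at most by the factor
    -- `Nat.card (H.map Φ)`, so more than `m` elements remain.
    obtain ⟨b, hb, hcard⟩ := hunb (m * Nat.card (H.map Φ))
    have hbfin : Finite (H.map (actRight 𝔤 b)) := hb.to_subtype
    have h1 : (actRight 𝔤 b).ker.relIndex H ≠ 0 := by
      rw [AddSubgroup.relIndex_ker]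
      exact Nat.card_pos.ne'
    have h2 : Φ.ker.relIndex H ≠ 0 := by
      rw [AddSubgroup.relIndex_ker]
      exact Nat.card_pos.ne'
    have h3 := AddSubgroup.relIndex_le_of_le_left (inf_le_left : (actRight 𝔤 b).ker ⊓ Φ.ker ≤ _)
      (AddSubgroup.relIndex_inf_ne_zero h1 h2)
    rw [← AddSubgroup.relIndex_inf_mul_relIndex, AddSubgroup.relIndex_ker,
      AddSubgroup.relIndex_ker, AddSubgroup.relIndex_ker] at h3
    have h4 : m < Nat.card ((Φ.ker ⊓ H).map (actRight 𝔤 b)) :=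
      lt_of_mul_lt_mul_right (hcard.trans_le h3) (Nat.zero_le _)
    have hpos : 0 < Nat.card ((Φ.ker ⊓ H).map (actRight 𝔤 b)) := (Nat.zero_le _).trans_lt h4
    have := (Nat.card_pos_iff.1 hpos).2
    let e := Finite.equivFin ((Φ.ker ⊓ H).map (actRight 𝔤 b))
    have hz (l : ℕ) : ∃ z ∈ Φ.ker ⊓ H, ∀ hl : l < m, actRight 𝔤 b z = e.symm ⟨l, hl.trans h4⟩ := by
      by_cases hl : l < m
      · obtain ⟨z, hz, h⟩ := (e.symm ⟨l, hl.trans h4⟩).2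
        exact ⟨z, hz, fun _ => h⟩
      · exact ⟨0, zero_mem _, fun h => absurd h hl⟩
    choose z hzm hz using hz
    -- The entries after position `k` are irrelevant, since only `i < k + 1` is tested.
    refine ⟨fun j => if j < k then a j else b, fun j => ?_, fun i hi => ?_⟩
    · dsimp only
      split_ifs
      · exact hfin j
      · exact hb
    · beta_reduce
      rcases (Nat.lt_succ_iff.1 hi).lt_or_eq with hi | rfl
      · obtain ⟨z, hz, hz'⟩ := ha i hi
        refine ⟨z, fun l => ⟨(hz l).1, fun j hj => ?_⟩, ?_⟩
        · rw [if_pos (hj.trans hi)]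
          exact (hz l).2 j hj
        · rwa [if_pos hi]
      · refine ⟨z, fun l => ⟨(hzm l).2, fun j hj => ?_⟩, fun l hl l' hl' h => ?_⟩
        · rw [if_pos hj]
          exact congrFun (hzm l).1 ⟨j, hj⟩
        · rw [if_neg (lt_irrefl _)] at h
          change actRight 𝔤 b (z l) = actRight 𝔤 b (z l') at h
          rw [hz l hl, hz l' hl'] at h
          exact congrArg Fin.val (e.symm.injective (Subtype.ext h))

end Chain

/-- In a finite-dimensional theory, the size of the finite orbits of a definable subgroup is
bounded. -/
theorem exists_card_orbit_bound {L : FirstOrder.Language.{u, v}} {T : L.Theory}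
    (hT : IsFiniteDimensional.{u, v, w} T) (M : T.ModelType.{u, v, w})
    {𝔤 : Type u₁} {A : Type u₂} [LieRing 𝔤] [AddCommGroup A] [LieRingModule 𝔤 A]
    (D : DefinableModule L M 𝔤 A) (H : AddSubgroup 𝔤) (hH : D.ring.IsDefinable (H : Set 𝔤)) :
    ∃ m : ℕ, ∀ a : A, (H.map (actRight 𝔤 a) : Set A).Finite →
      Nat.card (H.map (actRight 𝔤 a)) ≤ m := by
  by_contra! hunb
  obtain ⟨d⟩ := hT
  choose code hcode using D.ring.exists_codes
  obtain ⟨k, m, hkm⟩ := exists_chain_bound d M hH ⟨code 0, 0, zero_mem H, hcode 0⟩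
    D.definable_lie_eq
  obtain ⟨a, -, ha⟩ := exists_annihilator_chain H hunb m k
  choose b hb using fun j => D.group.exists_codes (a j)
  have key (j : ℕ) {x y : Fin D.ring.arity → M} {g g' : 𝔤} (hx : D.ring.Codes x g)
      (hy : D.ring.Codes y g') : Sum.elim (Sum.elim x y) (b j) ∈
        {v : (Fin D.ring.arity ⊕ Fin D.ring.arity) ⊕ Fin D.group.arity → M | ∃ x y a,
        D.ring.Codes (v ∘ Sum.inl ∘ Sum.inl) x ∧ D.ring.Codes (v ∘ Sum.inl ∘ Sum.inr) y ∧
          D.group.Codes (v ∘ Sum.inr) a ∧ ⁅x, a⁆ = ⁅y, a⁆} ↔ ⁅g, a j⁆ = ⁅g', a j⁆ := by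
    constructor
    · rintro ⟨g₁, g₁', c, h1, h2, h3, h⟩
      rw [hx.unique h1, hy.unique h2, (hb j).unique h3]
      exact h
    · exact fun h => ⟨g, g', a j, hx, hy, hb j, h⟩
  obtain ⟨i, hi, x, ⟨g, hg, hx⟩, h⟩ := hkm b fun j => by
    refine ⟨?_, ?_, ?_⟩
    · rintro ⟨x, g, hg, hx⟩
      exact (key j hx hx).2 rfl
    · rintro ⟨x, g, hg, hx⟩ ⟨y, g', hg', hy⟩ h
      exact (key j hy hx).2 ((key j hx hy).1 h).symm
    · rintro ⟨x, g, hg, hx⟩ ⟨y, g', hg', hy⟩ ⟨z, g'', hg'', hz⟩ h h'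
      exact (key j hx hz).2 (((key j hx hy).1 h).trans ((key j hy hz).1 h'))
  obtain ⟨z, hz, hz'⟩ := ha i hi
  -- Every class is a translate of the annihilator: `g + z l` agrees with `g` on all `a j` with `j <
  -- i`.
  obtain ⟨l, hl, l', hl', hne, h⟩ := h (fun l => code (g + z l)) fun l =>
    ⟨⟨_, add_mem hg (hz l).1, hcode _⟩, fun j hj => (key j hx (hcode _)).2 (by
      rw [add_lie, (hz l).2 j hj, add_zero])⟩
  refine hne (hz' l hl l' hl' ?_)
  have h := (key i (hcode _) (hcode _)).1 h
  rwa [add_lie, add_lie, add_right_inj] at h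

/-! ### Almost centralisers when orbits are bounded -/

section Centraliser

variable {𝔤 A : Type*} [LieRing 𝔤] [AddCommGroup A] [LieRingModule 𝔤 A]

theorem mem_almostCentralizerIn {𝔥 : LieIdeal ℤ 𝔤} {a : A} :
    a ∈ almostCentralizerIn A 𝔥 ↔
      (𝔥.toSubmodule.toAddSubgroup.map (actRight 𝔤 a) : Set A).Finite :=
  almostLE_bot_iff _

theorem mem_almostCentralizerOf {𝔥 : LieIdeal ℤ 𝔤} {B : LieSubmodule ℤ 𝔤 A} {x : 𝔤} :
    x ∈ almostCentralizerOf 𝔥 B ↔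
      x ∈ 𝔥 ∧ (B.toSubmodule.toAddSubgroup.map (actLeft A x) : Set A).Finite :=
  and_congr_right fun _ => almostLE_bot_iff _

/-- Finiteness of an orbit becomes finite index of an annihilator, and finite index is stable under
intersections. -/
theorem finite_map_iff_relIndex {G G' : Type*} [AddCommGroup G] [AddCommGroup G'] (f : G →+ G')
    (H : AddSubgroup G) : (H.map f : Set G').Finite ↔ f.ker.relIndex H ≠ 0 := by
  rw [AddSubgroup.relIndex_ker, ← Nat.pos_iff_ne_zero, Nat.card_pos_iff]
  exact ⟨fun h => ⟨⟨0⟩, h.to_subtype⟩, fun h => Set.finite_coe_iff.1 h.2⟩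

theorem relIndex_ne_zero_of_le {G : Type*} [AddCommGroup G] {K K' H H' : AddSubgroup G}
    (h : K.relIndex H ≠ 0) (hK : K ≤ K') (hH : H' ≤ H) : K'.relIndex H' ≠ 0 :=
  fun h0 => h (AddSubgroup.relIndex_eq_zero_of_le_left hK
    (AddSubgroup.relIndex_eq_zero_of_le_right hH h0))

theorem relIndex_ne_zero_of_finiteIndex {G : Type*} [AddCommGroup G] {K : AddSubgroup G}
    (hK : K.FiniteIndex) (H : AddSubgroup G) : K.relIndex H ≠ 0 :=
  fun h => hK.index_ne_zero
    (Nat.eq_zero_of_zero_dvd (h ▸ AddSubgroup.relIndex_dvd_index_of_normal K H))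

open scoped Pointwise in
/-- If the orbits of `H` on `B` are of bounded size, then almost all of `H` almost centralises
`B`. -/
theorem relIndex_ne_zero_of_orbit_bound (H H₁ : AddSubgroup 𝔤) (B : AddSubgroup A) (m : ℕ)
    (hfin : ∀ b ∈ B, (H.map (actRight 𝔤 b) : Set A).Finite)
    (hcard : ∀ b ∈ B, Nat.card (H.map (actRight 𝔤 b)) ≤ m)
    (hH₁ : ∀ x ∈ H, (B.map (actLeft A x) : Set A).Finite → x ∈ H₁) : H₁.relIndex H ≠ 0 := by
  classical
  intro h0
  have hinf : Infinite (H ⧸ H₁.addSubgroupOf H) := by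
    have h0 : Nat.card (H ⧸ H₁.addSubgroupOf H) = 0 := h0
    exact (Nat.card_eq_zero.1 h0).resolve_left (not_isEmpty_of_nonempty _)
  let e := Infinite.natEmbedding (H ⧸ H₁.addSubgroupOf H)
  have hx (i : ℕ) : ∃ x : H, (QuotientAddGroup.mk x : H ⧸ H₁.addSubgroupOf H) = e i :=
    QuotientAddGroup.mk_surjective _
  choose x hx using hx
  have hsub (i j : ℕ) (h : (x i : 𝔤) - x j ∈ H₁) : i = j := by
    refine e.injective ?_
    rw [← hx, ← hx, eq_comm, QuotientAddGroup.eq, AddSubgroup.mem_addSubgroupOf]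
    rwa [sub_eq_neg_add] at h
  let s : Finset (Fin (m + 1) × Fin (m + 1)) := Finset.univ.filter fun p => p.1 ≠ p.2
  let K (p : Fin (m + 1) × Fin (m + 1)) : AddSubgroup B :=
    ((actLeft A ((x p.1 : 𝔤) - x p.2)).comp B.subtype).ker
  -- Pigeonhole: an orbit has at most `m` elements, so two of `m + 1` coset representatives agree on
  -- `b`. The kernels of the differences cover `B`.
  have hcov : ⋃ p ∈ s, (0 : B) +ᵥ (K p : Set B) = Set.univ := by
    refine Set.eq_univ_of_forall fun b => ?_
    have := (hfin b b.2).to_subtype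
    obtain ⟨i, j, hij, h⟩ := Fintype.exists_ne_map_eq_of_card_lt
      (fun i : Fin (m + 1) => Finite.equivFin (H.map (actRight 𝔤 (b : A))) ⟨⁅(x i : 𝔤), (b : A)⁆,
        x i, (x i).2, rfl⟩)
      (by simpa using Nat.lt_succ_of_le (hcard b b.2))
    have h := congrArg Subtype.val ((Finite.equivFin _).injective h)
    refine Set.mem_iUnion₂.2 ⟨(i, j), by simpa [s] using hij, ?_⟩
    rw [zero_vadd]
    change ⁅(x i : 𝔤) - x j, (b : A)⁆ = 0
    rw [sub_lie, sub_eq_zero]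
    exact h
  -- By Neumann's lemma one of the kernels has finite index. Then `x i - x j` almost centralises
  -- `B`, so it lies in `H₁`, although the cosets are distinct.
  obtain ⟨⟨i, j⟩, hp, hK⟩ := AddSubgroup.exists_finiteIndex_of_leftCoset_cover hcov
  have hij : i ≠ j := by simpa [s] using hp
  refine hij (Fin.ext (hsub i j (hH₁ _ (H.sub_mem (x i).2 (x j).2) ?_)))
  have : B.map (actLeft A ((x i : 𝔤) - x j)) =
      (⊤ : AddSubgroup B).map ((actLeft A ((x i : 𝔤) - x j)).comp B.subtype) := by
    rw [← AddSubgroup.map_map, ← AddMonoidHom.range_eq_map, AddSubgroup.range_subtype]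
  rw [this, finite_map_iff_relIndex]
  exact relIndex_ne_zero_of_finiteIndex hK _

/-- If the orbits of `H` on `B` are of bounded size and `H` almost centralises `B`, then there are
only finitely many products. -/
theorem finite_lie_of_orbit_bound (H : AddSubgroup 𝔤) (B : AddSubgroup A) (m : ℕ)
    (hfin : ∀ b ∈ B, (H.map (actRight 𝔤 b) : Set A).Finite)
    (hcard : ∀ b ∈ B, Nat.card (H.map (actRight 𝔤 b)) ≤ m)
    (hH : ∀ x ∈ H, (B.map (actLeft A x) : Set A).Finite) :
    {c : A | ∃ x ∈ H, ∃ b ∈ B, ⁅x, b⁆ = c}.Finite := by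
  let S : Set ℕ := {k | ∃ b ∈ B, Nat.card (H.map (actRight 𝔤 b)) = k}
  have hbdd : BddAbove S := ⟨m, by
    rintro _ ⟨b, hb, rfl⟩
    exact hcard b hb⟩
  -- The element `b₁` has an orbit of maximal size.
  obtain ⟨b₁, hb₁, hmax⟩ : sSup S ∈ S := Nat.sSup_mem ⟨_, 0, zero_mem B, rfl⟩ hbdd
  have hF := (hfin b₁ hb₁).to_subtype
  have hx (c : H.map (actRight 𝔤 b₁)) : ∃ x ∈ H, ⁅x, b₁⁆ = (c : A) := c.2
  choose x hxH hx using hx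
  -- The map `Ψ` records the action of one representative `x c` for each element `c` of the orbit of
  -- `b₁`. If `Ψ b = 0`, the orbit of `b₁ + b` contains that of `b₁`, so by maximality they are
  -- equal and `H · b` lies in `H · b₁`.
  let Ψ : A →+ (H.map (actRight 𝔤 b₁) → A) := AddMonoidHom.pi fun c => actLeft A (x c)
  have hker (b : A) (hb : b ∈ B) (h : Ψ b = 0) (y : 𝔤) (hy : y ∈ H) :
      ⁅y, b⁆ ∈ H.map (actRight 𝔤 b₁) := by
    have hle : H.map (actRight 𝔤 b₁) ≤ H.map (actRight 𝔤 (b₁ + b)) := fun c hc => by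
      refine ⟨x ⟨c, hc⟩, hxH _, ?_⟩
      have h0 : ⁅x ⟨c, hc⟩, b⁆ = 0 := congrFun h ⟨c, hc⟩
      rw [actRight_apply, lie_add, h0, add_zero, hx]
    have := (hfin _ (add_mem hb₁ hb)).to_subtype
    have heq := AddSubgroup.eq_of_le_of_card_ge hle
      ((le_csSup hbdd ⟨_, add_mem hb₁ hb, rfl⟩).trans_eq hmax.symm)
    have h1 : ⁅y, b₁ + b⁆ ∈ H.map (actRight 𝔤 b₁) := by
      rw [heq]
      exact ⟨y, hy, rfl⟩
    rw [lie_add] at h1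
    have h2 : ⁅y, b₁⁆ ∈ H.map (actRight 𝔤 b₁) := ⟨y, hy, rfl⟩
    exact (add_mem_cancel_left h2).1 h1
  -- Each `x c` almost centralises `B`, so finitely many representatives `r v` cover `B` modulo the
  -- kernel of `Ψ`. All products lie in the union of the `H · r v`, plus `H · b₁`.
  have hΨ : Finite (B.map Ψ) := by
    refine ((Set.Finite.pi' fun c => hH (x c) (hxH c)).subset ?_).to_subtype
    rintro _ ⟨b, hb, rfl⟩ c
    exact ⟨b, hb, rfl⟩
  have hr (v : B.map Ψ) : ∃ b ∈ B, Ψ b = v := v.2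
  choose r hrB hr using hr
  refine ((Set.finite_iUnion fun v => hfin (r v) (hrB v)).add (hfin b₁ hb₁)).subset ?_
  rintro _ ⟨y, hy, b, hb, rfl⟩
  let v : B.map Ψ := ⟨Ψ b, b, hb, rfl⟩
  refine ⟨⁅y, r v⁆, Set.mem_iUnion.2 ⟨v, y, hy, rfl⟩, ⁅y, b - r v⁆,
    hker _ (sub_mem hb (hrB v)) ?_ y hy, ?_⟩
  · rw [map_sub, hr, sub_self]
  · change ⁅y, r v⁆ + ⁅y, b - r v⁆ = ⁅y, b⁆
    rw [← lie_add, add_sub_cancel]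

/-- If the orbits of `𝔥` on its almost centraliser are of bounded size, then the almost centraliser
of the almost centraliser centralises. -/
theorem lie_eq_zero_of_orbit_bound (hA : almostCentralizerIn A (⊤ : LieIdeal ℤ 𝔤) = ⊥)
    (𝔥 : LieIdeal ℤ 𝔤) (m : ℕ)
    (hcard : ∀ a : A, (𝔥.toSubmodule.toAddSubgroup.map (actRight 𝔤 a) : Set A).Finite →
      Nat.card (𝔥.toSubmodule.toAddSubgroup.map (actRight 𝔤 a)) ≤ m) :
    ∀ x ∈ almostCentralizerOf 𝔥 (almostCentralizerIn A 𝔥),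
      ∀ a ∈ almostCentralizerIn A 𝔥, ⁅x, a⁆ = 0 := by
  set B := almostCentralizerIn A 𝔥 with hB
  set 𝔥₁ := almostCentralizerOf 𝔥 B with hh
  have hle : 𝔥₁.toSubmodule.toAddSubgroup ≤ 𝔥.toSubmodule.toAddSubgroup := fun x hx => hx.1
  have hfinB (b : A) (hb : b ∈ B) := mem_almostCentralizerIn.1 hb
  have hS := finite_lie_of_orbit_bound 𝔥₁.toSubmodule.toAddSubgroup B.toSubmodule.toAddSubgroup m
    (fun b hb => (hfinB b hb).subset (AddSubgroup.map_mono hle))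
    (fun b hb => (Nat.card_mono (hfinB b hb) (AddSubgroup.map_mono hle)).trans
      (hcard b (hfinB b hb)))
    fun x hx => (mem_almostCentralizerOf.1 hx).2
  intro x hx a ha
  -- By the Leibniz rule, `g` sends `⁅x, a⁆` to a sum of two elements of the finite set of products.
  have : ⁅x, a⁆ ∈ almostCentralizerIn A (⊤ : LieIdeal ℤ 𝔤) := by
    refine mem_almostCentralizerIn.2 ((hS.add hS).subset ?_)
    rintro _ ⟨g, -, rfl⟩
    exact ⟨_, ⟨⁅g, x⁆, 𝔥₁.lie_mem hx, a, ha, rfl⟩, _, ⟨x, hx, ⁅g, a⁆, B.lie_mem ha, rfl⟩,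
      (leibniz_lie g x a).symm⟩
  rw [hA] at this
  exact (LieSubmodule.mem_bot _).1 this

end Centraliser

/-! ### Almost derivations that vanish on almost all of an ideal -/

section Cohomology

variable {𝔤 A : Type*} [LieRing 𝔤] [AddCommGroup A] [LieRingModule 𝔤 A]

theorem AlmostH1.exists_mk (c : AlmostH1 𝔤 A) :
    ∃ (f : PartialHom 𝔤 A) (hf : f.IsAlmostDerivation), AlmostH1.mk f hf = c := by
  obtain ⟨⟨_, f, hf, rfl⟩, rfl⟩ := QuotientAddGroup.mk_surjective c
  exact ⟨f, hf, rfl⟩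

theorem AlmostH1.mk_congr {f f' : PartialHom 𝔤 A} (hf : f.IsAlmostDerivation)
    (hf' : f'.IsAlmostDerivation) (h : PHomClass.mk f = PHomClass.mk f') :
    AlmostH1.mk f hf = AlmostH1.mk f' hf' :=
  congrArg QuotientAddGroup.mk (Subtype.ext h)

theorem AlmostH1.mk_eq_zero_iff {f : PartialHom 𝔤 A} (hf : f.IsAlmostDerivation) :
    AlmostH1.mk f hf = 0 ↔ ∃ (a : A) (K : AddSubgroup 𝔤), K.FiniteIndex ∧
      ∀ x ∈ K, ∃ hx : x ∈ f.dom, f.toFun ⟨x, hx⟩ = ⁅x, a⁆ := by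
  refine (QuotientAddGroup.eq_zero_iff _).trans ?_
  rw [AddSubgroup.mem_addSubgroupOf]
  constructor
  · rintro ⟨a, ha⟩
    obtain ⟨K, hK, h⟩ := (PartialHom.equivalent_iff _ _).1 (PHomClass.mk_eq_iff.1 ha)
    refine ⟨a, K, hK, fun x hx => ?_⟩
    obtain ⟨_, h2, h3⟩ := h x hx
    exact ⟨h2, h3.symm⟩
  · rintro ⟨a, K, hK, h⟩
    refine ⟨a, PHomClass.mk_eq hK fun x hx => ?_⟩
    obtain ⟨h2, h3⟩ := h x hx
    exact ⟨trivial, h2, h3.symm⟩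

theorem AlmostH1.mk_add_neg_inner {f : PartialHom 𝔤 A} (hf : f.IsAlmostDerivation) (a : A) :
    AlmostH1.mk (f + -PartialHom.inner 𝔤 a)
      (hf.add (PartialHom.inner_isAlmostDerivation a).neg) = AlmostH1.mk f hf := by
  have h0 : AlmostH1.mk _ (PartialHom.inner_isAlmostDerivation (𝔤 := 𝔤) a) = 0 :=
    (AlmostH1.mk_eq_zero_iff _).2 ⟨a, ⊤, inferInstance, fun x _ => ⟨trivial, rfl⟩⟩
  have h : AlmostH1.mk (f + -PartialHom.inner 𝔤 a)
      (hf.add (PartialHom.inner_isAlmostDerivation a).neg) =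
      AlmostH1.mk f hf + -AlmostH1.mk _ (PartialHom.inner_isAlmostDerivation (𝔤 := 𝔤) a) := rfl
  rw [h, h0, neg_zero, add_zero]

variable {𝔥 : LieIdeal ℤ 𝔤}

/-- An almost derivation that vanishes on almost all of `𝔥` takes almost all values in the almost
centraliser of `𝔥`. -/
theorem PartialHom.apply_mem_almostCentralizerIn {f : PartialHom 𝔤 A} {K : AddSubgroup 𝔤}
    (hK : K.relIndex 𝔥.toSubmodule.toAddSubgroup ≠ 0)
    (hf : ∀ x ∈ K, ∃ hx : x ∈ f.dom, f.toFun ⟨x, hx⟩ = 0) {g : 𝔤} (hg : g ∈ f.dom)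
    (hfg : (f.derivAt ⟨g, hg⟩).FiniteIndex) : f.toFun ⟨g, hg⟩ ∈ almostCentralizerIn A 𝔥 := by
  rw [mem_almostCentralizerIn, finite_map_iff_relIndex]
  -- Since `g` maps `𝔥` into itself, `⁅g, x⁆ ∈ K` for almost all `x ∈ 𝔥`.
  have h1 : (K.comap (actLeft 𝔤 g)).relIndex 𝔥.toSubmodule.toAddSubgroup ≠ 0 := by
    rw [AddSubgroup.relIndex_comap]
    refine relIndex_ne_zero_of_le hK le_rfl ?_
    rintro _ ⟨x, hx, rfl⟩
    exact 𝔥.lie_mem hx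
  -- On this intersection the derivation identity reads `0 = 0 - ⁅x, f g⁆`.
  refine relIndex_ne_zero_of_le (AddSubgroup.relIndex_inf_ne_zero
    (AddSubgroup.relIndex_inf_ne_zero hK h1) (relIndex_ne_zero_of_finiteIndex hfg _)) ?_ le_rfl
  rintro x ⟨⟨hx, hgx⟩, ⟨hxd, hgxd, e⟩⟩
  obtain ⟨_, h2⟩ := hf x hx
  obtain ⟨_, h3⟩ := hf _ hgx
  change ⁅x, f.toFun ⟨g, hg⟩⁆ = 0
  have h3' : f.toFun ⟨⁅g, x⁆, hgxd⟩ = 0 := h3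
  rw [h2, lie_zero, zero_sub] at e
  rw [← neg_eq_zero, ← e]
  exact h3

/-- An almost derivation that vanishes on almost all of `𝔥` vanishes on the part of its derivation
domain that annihilates the almost centraliser of `𝔥`. -/
theorem PartialHom.apply_eq_zero (hA : almostCentralizerIn A (⊤ : LieIdeal ℤ 𝔤) = ⊥)
    {f : PartialHom 𝔤 A} (hfd : f.IsAlmostDerivation) {K : AddSubgroup 𝔤}
    (hK : K.relIndex 𝔥.toSubmodule.toAddSubgroup ≠ 0)
    (hf : ∀ x ∈ K, ∃ hx : x ∈ f.dom, f.toFun ⟨x, hx⟩ = 0) {x : 𝔤} (hx𝔥 : x ∈ 𝔥)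
    (hxA : ∀ a ∈ almostCentralizerIn A 𝔥, ⁅x, a⁆ = 0) (hx : x ∈ f.dom)
    (hfx : (f.derivAt ⟨x, hx⟩).FiniteIndex) : f.toFun ⟨x, hx⟩ = 0 := by
  suffices h : f.toFun ⟨x, hx⟩ ∈ almostCentralizerIn A (⊤ : LieIdeal ℤ 𝔤) by
    rw [hA] at h
    exact (LieSubmodule.mem_bot _).1 h
  -- As `f` vanishes on almost all of `𝔥`, it takes only finitely many values there.
  have hfin : ((𝔥.toSubmodule.toAddSubgroup.addSubgroupOf f.dom).map f.toFun : Set A).Finite := by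
    rw [finite_map_iff_relIndex]
    have h1 : (K.comap f.dom.subtype).relIndex
        (𝔥.toSubmodule.toAddSubgroup.addSubgroupOf f.dom) ≠ 0 := by
      rw [AddSubgroup.relIndex_comap]
      refine relIndex_ne_zero_of_le hK le_rfl ?_
      rintro _ ⟨y, hy, rfl⟩
      exact hy
    refine relIndex_ne_zero_of_le h1 ?_ le_rfl
    intro y hy
    exact (hf y hy).2
  rw [mem_almostCentralizerIn, finite_map_iff_relIndex]
  -- For these `y` the value `f y` lies in the almost centraliser of `𝔥` and is killed by `x`. So
  -- `⁅y, f x⁆ = -f ⁅x, y⁆`, where `⁅x, y⁆ ∈ 𝔥`.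
  have h1 : (actRight 𝔤 (f.toFun ⟨x, hx⟩)).ker.relIndex (f.derivAt ⟨x, hx⟩ ⊓ f.derivDom) ≠ 0 := by
    rw [← finite_map_iff_relIndex]
    refine (hfin.image (- ·)).subset ?_
    rintro _ ⟨y, ⟨⟨hy, hxy, e⟩, ⟨hy', hfy⟩⟩, rfl⟩
    refine ⟨_, ⟨⟨_, hxy⟩, lie_mem_left ℤ 𝔤 𝔥 x y hx𝔥, rfl⟩, ?_⟩
    rw [hxA _ (PartialHom.apply_mem_almostCentralizerIn hK hf hy' hfy), zero_sub] at e
    change -f.toFun ⟨⁅x, y⁆, hxy⟩ = ⁅y, f.toFun ⟨x, hx⟩⁆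
    rw [e, neg_neg]
  have h2 : (f.derivAt ⟨x, hx⟩ ⊓ f.derivDom).relIndex
      (⊤ : LieIdeal ℤ 𝔤).toSubmodule.toAddSubgroup ≠ 0 :=
    AddSubgroup.relIndex_inf_ne_zero (relIndex_ne_zero_of_finiteIndex hfx _)
      (relIndex_ne_zero_of_finiteIndex hfd _)
  exact AddSubgroup.relIndex_ne_zero_trans h1 h2

/-- A homomorphism from a subgroup that vanishes on the kernel of `φ` descends along `φ`. -/
theorem exists_descend {G G' H : Type*} [AddCommGroup G] [AddCommGroup G'] [AddCommGroup H]
    (φ : G →+ G') (P : AddSubgroup G) (f : P →+ H) (h : ∀ x : P, φ x = 0 → f x = 0) :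
    ∃ f' : P.map φ →+ H, ∀ x : P, f' ⟨φ x, x, x.2, rfl⟩ = f x := by
  have hs : Function.Surjective (φ.addSubgroupMap P) := φ.addSubgroupMap_surjective P
  refine ⟨AddMonoidHom.liftOfSurjective _ hs ⟨f, fun x hx => h x ?_⟩, fun x => ?_⟩
  · exact congrArg Subtype.val hx
  · exact AddMonoidHom.liftOfRightInverse_comp_apply _ _ (Function.rightInverse_surjInv hs)
      ⟨f, _⟩ x

end Cohomology

/-! ### Exactness of the inflation-restriction sequence -/

section Inflation

variable {𝔤 A : Type*} [LieRing 𝔤] [AddCommGroup A] [LieRingModule 𝔤 A]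
  (I : LieIdeal ℤ 𝔤) (B : LieSubmodule ℤ 𝔤 A)

/-- The partial homomorphism `x ↦ f (x + I)`, with values in `A`. -/
def PartialHom.inflate (f : PartialHom (𝔤 ⧸ I) B) : PartialHom 𝔤 A :=
  f.transport (quotientHom I : 𝔤 →+ 𝔤 ⧸ I) B.toSubmodule.subtype.toAddMonoidHom

variable {I B} (h : ∀ x ∈ I, ∀ b ∈ B, ⁅x, b⁆ = 0)

theorem PartialHom.IsAlmostDerivation.inflate {f : PartialHom (𝔤 ⧸ I) B}
    (hf : letI := quotientModule I B h; f.IsAlmostDerivation) :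
    (f.inflate I B).IsAlmostDerivation :=
  let _ := quotientModule I B h
  hf.transport (quotientHom I) B.toSubmodule.subtype.toAddMonoidHom fun _ _ => rfl

theorem inflation'_mk {f : PartialHom (𝔤 ⧸ I) B}
    (hf : letI := quotientModule I B h; f.IsAlmostDerivation) :
    letI := quotientModule I B h
    inflation' I B h (AlmostH1.mk f hf) = AlmostH1.mk (f.inflate I B) (hf.inflate h) :=
  rfl

/-- If an inflated map is almost everywhere `x ↦ ⁅x, a⁆`, then `a` is annihilated by almost all of
`I`, hence of `𝔥`. So `a` lies in the almost centraliser, and the map is already inner on the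
quotient. -/
theorem inflation'_injective {𝔥 : LieIdeal ℤ 𝔤}
    (hI : I.toSubmodule.toAddSubgroup.relIndex 𝔥.toSubmodule.toAddSubgroup ≠ 0)
    (h : ∀ x ∈ I, ∀ b ∈ almostCentralizerIn A 𝔥, ⁅x, b⁆ = 0) :
    Function.Injective (inflation' I (almostCentralizerIn A 𝔥) h) := by
  let _ := quotientModule I (almostCentralizerIn A 𝔥) h
  refine (injective_iff_map_eq_zero _).2 fun c hc => ?_
  obtain ⟨f, hf, rfl⟩ := AlmostH1.exists_mk c
  rw [inflation'_mk, AlmostH1.mk_eq_zero_iff] at hc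
  obtain ⟨a, K, hK, hfa⟩ := hc
  have ha : a ∈ almostCentralizerIn A 𝔥 := by
    rw [mem_almostCentralizerIn, finite_map_iff_relIndex]
    refine relIndex_ne_zero_of_le
      (AddSubgroup.relIndex_inf_ne_zero (relIndex_ne_zero_of_finiteIndex hK _) hI) ?_ le_rfl
    rintro x ⟨hxK, hxI⟩
    obtain ⟨hx, e⟩ := hfa x hxK
    have h0 : (⟨quotientHom I x, hx⟩ : f.dom) = 0 :=
      Subtype.ext ((Submodule.Quotient.mk_eq_zero I.toSubmodule).2 hxI)
    change ((f.toFun ⟨quotientHom I x, hx⟩ : almostCentralizerIn A 𝔥) : A) = _ at e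
    rw [h0, map_zero] at e
    exact e.symm
  rw [AlmostH1.mk_eq_zero_iff]
  refine ⟨⟨a, ha⟩, K.map (quotientHom I : 𝔤 →+ 𝔤 ⧸ I), ?_, ?_⟩
  · exact AddSubgroup.finiteIndex_iff.2 fun h0 => hK.index_ne_zero (Nat.eq_zero_of_zero_dvd (h0 ▸
      AddSubgroup.index_map_dvd K (Submodule.mkQ_surjective I.toSubmodule)))
  · rintro _ ⟨x, hxK, rfl⟩
    obtain ⟨hx, e⟩ := hfa x hxK
    exact ⟨hx, Subtype.ext e⟩

theorem restriction_mk {𝔥 : LieIdeal ℤ 𝔤} {f : PartialHom 𝔤 A} (hf : f.IsAlmostDerivation) :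
    restriction A 𝔥 (AlmostH1.mk f hf) =
      AlmostH1.mk (f.transport (𝔥.incl : 𝔥 →+ 𝔤) (AddMonoidHom.id A))
        (hf.transport 𝔥.incl (AddMonoidHom.id A) fun _ _ => rfl) :=
  rfl

/-- An inflated map vanishes on `I`, which contains almost all of `𝔥`. -/
theorem restriction_inflation' {𝔥 : LieIdeal ℤ 𝔤}
    (hI : I.toSubmodule.toAddSubgroup.relIndex 𝔥.toSubmodule.toAddSubgroup ≠ 0)
    (c : letI := quotientModule I B h; AlmostH1 (𝔤 ⧸ I) B) :
    restriction A 𝔥 (inflation' I B h c) = 0 := by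
  let _ := quotientModule I B h
  obtain ⟨f, hf, rfl⟩ := AlmostH1.exists_mk c
  rw [inflation'_mk, restriction_mk, AlmostH1.mk_eq_zero_iff]
  refine ⟨0, I.toSubmodule.toAddSubgroup.comap (𝔥.incl : 𝔥 →+ 𝔤),
    AddSubgroup.finiteIndex_iff.2 ?_, fun x hx => ?_⟩
  · rw [AddSubgroup.index_comap]
    refine relIndex_ne_zero_of_le hI le_rfl ?_
    rintro _ ⟨x, rfl⟩
    exact x.2
  · have h0 : quotientHom I (x : 𝔤) = 0 := (Submodule.Quotient.mk_eq_zero I.toSubmodule).2 hx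
    have hd : quotientHom I (x : 𝔤) ∈ f.dom := by
      rw [h0]
      exact zero_mem _
    refine ⟨hd, ?_⟩
    have h0' : (⟨quotientHom I (x : 𝔤), hd⟩ : f.dom) = 0 := Subtype.ext h0
    change ((f.toFun ⟨quotientHom I (x : 𝔤), hd⟩ : B) : A) = _
    rw [h0', map_zero, lie_zero]
    rfl

/-- An almost derivation that takes almost all values in `B` and vanishes on almost all of `I`
is inflated from `𝔤 ⧸ I`. -/
theorem exists_inflate {f : PartialHom 𝔤 A} (hf : f.IsAlmostDerivation)
    (hB : ∀ (x : 𝔤) (hx : x ∈ f.dom), x ∈ f.derivDom → f.toFun ⟨x, hx⟩ ∈ B)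
    (hI : ∀ (x : 𝔤) (hx : x ∈ f.dom), x ∈ f.derivDom → x ∈ I → f.toFun ⟨x, hx⟩ = 0) :
    letI := quotientModule I B h
    ∃ (f' : PartialHom (𝔤 ⧸ I) B) (hf' : f'.IsAlmostDerivation),
      AlmostH1.mk (f'.inflate I B) (hf'.inflate h) = AlmostH1.mk f hf := by
  let _ := quotientModule I B h
  let π : 𝔤 →+ 𝔤 ⧸ I := quotientHom I
  have hπ : Function.Surjective π := Submodule.mkQ_surjective I.toSubmodule
  have hmap {K : AddSubgroup 𝔤} (hK : K.FiniteIndex) : (K.map π).FiniteIndex :=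
    AddSubgroup.finiteIndex_iff.2 fun h0 => hK.index_ne_zero (Nat.eq_zero_of_zero_dvd (h0 ▸
      AddSubgroup.index_map_dvd K hπ))
  have hle : f.derivDom ≤ f.dom := fun x hx => hx.1
  -- The restriction of `f` to `D^f` takes all its values in `B` and vanishes on `I`, so it descends
  -- to the quotient.
  let F : f.derivDom →+ B :=
    (f.toFun.comp (AddSubgroup.inclusion hle)).codRestrict B.toSubmodule.toAddSubgroup
      fun x => hB x (hle x.2) x.2
  obtain ⟨F', hF'⟩ := exists_descend π f.derivDom F fun x hx => Subtype.ext
    (hI x (hle x.2) x.2 ((Submodule.Quotient.mk_eq_zero I.toSubmodule).1 hx))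
  let f' : PartialHom (𝔤 ⧸ I) B := ⟨f.derivDom.map π, hmap hf, F'⟩
  have hval (x : 𝔤) (hx : x ∈ f.derivDom) (hx' : π x ∈ f'.dom) :
      ((f'.toFun ⟨π x, hx'⟩ : B) : A) = f.toFun ⟨x, hle hx⟩ :=
    congrArg Subtype.val (hF' ⟨x, hx⟩)
  have hf' : f'.IsAlmostDerivation := by
    have := hmap hf
    refine AddSubgroup.finiteIndex_of_le (H := f.derivDom.map π) ?_
    rintro _ ⟨g, hg, rfl⟩
    refine ⟨⟨g, hg, rfl⟩, ?_⟩
    obtain ⟨hgd, hgi⟩ := id hg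
    have h1 := show f.derivDom.FiniteIndex from hf
    have h2 := PartialHom.finiteIndex_comap (actLeft 𝔤 g) h1
    -- The domain of `f'` is the image of `D^f`, not of `dom f`; so both `x` and `⁅g, x⁆` have to
    -- lie in `D^f`.
    have h3 := hmap (inferInstance :
      (f.derivAt ⟨g, hgd⟩ ⊓ f.derivDom ⊓ f.derivDom.comap (actLeft 𝔤 g)).FiniteIndex)
    refine AddSubgroup.finiteIndex_of_le
      (H := (f.derivAt ⟨g, hgd⟩ ⊓ f.derivDom ⊓ f.derivDom.comap (actLeft 𝔤 g)).map π) ?_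
    rintro _ ⟨x, ⟨⟨⟨hxd, hgxd, e⟩, hx⟩, hgx⟩, rfl⟩
    refine ⟨⟨x, hx, rfl⟩, ⟨⁅g, x⁆, hgx, rfl⟩, Subtype.ext ?_⟩
    change ((f'.toFun ⟨π ⁅g, x⁆, ⟨⁅g, x⁆, hgx, rfl⟩⟩ : B) : A) =
      ⁅g, ((f'.toFun ⟨π x, ⟨x, hx, rfl⟩⟩ : B) : A)⁆ - ⁅x, ((f'.toFun ⟨π g, ⟨g, hg, rfl⟩⟩ : B) : A)⁆
    have e1 := hval ⁅g, x⁆ hgx ⟨⁅g, x⁆, hgx, rfl⟩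
    have e2 := hval x hx ⟨x, hx, rfl⟩
    have e3 := hval g hg ⟨g, hg, rfl⟩
    exact e1.trans (e.trans (congrArg₂ (fun a b => ⁅g, a⁆ - ⁅x, b⁆) e2.symm e3.symm))
  refine ⟨f', hf', AlmostH1.mk_congr _ _ (PHomClass.mk_eq hf fun x hx => ?_)⟩
  exact ⟨⟨x, hx, rfl⟩, hle hx, hval x hx _⟩

/-- On a finite-index subgroup of `𝔥`, `f` agrees with an inner derivation. Subtracting it keeps the
class and yields a map that vanishes on almost all of `𝔥`, which is what `exists_inflate` needs
through `apply_mem_almostCentralizerIn` and `apply_eq_zero`. -/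
theorem mem_range_inflation' (hA : almostCentralizerIn A (⊤ : LieIdeal ℤ 𝔤) = ⊥)
    {𝔥 : LieIdeal ℤ 𝔤} (hI : I ≤ 𝔥)
    (h : ∀ x ∈ I, ∀ b ∈ almostCentralizerIn A 𝔥, ⁅x, b⁆ = 0) (c : AlmostH1 𝔤 A)
    (hc : restriction A 𝔥 c = 0) :
    c ∈ Set.range (inflation' I (almostCentralizerIn A 𝔥) h) := by
  obtain ⟨f, hf, rfl⟩ := AlmostH1.exists_mk c
  rw [restriction_mk, AlmostH1.mk_eq_zero_iff] at hc
  obtain ⟨a, K, hK, hfa⟩ := hc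
  let F : PartialHom 𝔤 A := f + -PartialHom.inner 𝔤 a
  have hF : F.IsAlmostDerivation := hf.add (PartialHom.inner_isAlmostDerivation a).neg
  let K' := K.map (𝔥.incl : 𝔥 →+ 𝔤)
  have hK' : K'.relIndex 𝔥.toSubmodule.toAddSubgroup ≠ 0 := by
    have e : 𝔥.toSubmodule.toAddSubgroup = (⊤ : AddSubgroup 𝔥).map (𝔥.incl : 𝔥 →+ 𝔤) := by
      ext x
      exact ⟨fun hx => ⟨⟨x, hx⟩, trivial, rfl⟩, fun ⟨y, _, hy⟩ => hy ▸ y.2⟩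
    rw [e, ← AddSubgroup.relIndex_comap, AddSubgroup.comap_map_eq_self_of_injective
      (f := (𝔥.incl : 𝔥 →+ 𝔤)) Subtype.val_injective, AddSubgroup.relIndex_top_right]
    exact hK.index_ne_zero
  have hzero : ∀ x ∈ K', ∃ hx : x ∈ F.dom, F.toFun ⟨x, hx⟩ = 0 := by
    rintro _ ⟨x, hx, rfl⟩
    obtain ⟨hxd, e⟩ := hfa x hx
    refine ⟨⟨hxd, trivial⟩, ?_⟩
    change f.toFun ⟨(x : 𝔤), hxd⟩ + -⁅(x : 𝔤), a⁆ = 0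
    exact add_neg_eq_zero.2 e
  obtain ⟨f', hf', e⟩ := exists_inflate h hF
    (fun x _ hx => PartialHom.apply_mem_almostCentralizerIn hK' hzero hx.1 hx.2)
    (fun x _ hx hxI => PartialHom.apply_eq_zero hA hF hK' hzero (hI hxI) (h x hxI) hx.1 hx.2)
  let _ := quotientModule I (almostCentralizerIn A 𝔥) h
  exact ⟨AlmostH1.mk f' hf', (inflation'_mk h hf').trans (e.trans (AlmostH1.mk_add_neg_inner hf a))⟩

end Inflation

end AlmCoh

theorem lemma5p2 {L : FirstOrder.Language.{u, v}} {T : L.Theory}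
    (hT : AlmCoh.IsFiniteDimensional.{u, v, w} T) (M : T.ModelType.{u, v, w})
    {𝔤 : Type u₁} {A : Type u₂} [LieRing 𝔤] [AddCommGroup A] [LieRingModule 𝔤 A]
    (D : AlmCoh.DefinableModule L M 𝔤 A)
    (hA : AlmCoh.almostCentralizerIn A (⊤ : LieIdeal ℤ 𝔤) = ⊥)
    (𝔥 : LieIdeal ℤ 𝔤) (h𝔥 : D.ring.IsDefinable (𝔥 : Set 𝔤)) :
    ∃ h : ∀ x ∈ AlmCoh.almostCentralizerOf 𝔥 (AlmCoh.almostCentralizerIn A 𝔥),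
        ∀ a ∈ AlmCoh.almostCentralizerIn A 𝔥, ⁅x, a⁆ = 0,
      Function.Injective (AlmCoh.inflation'
        (AlmCoh.almostCentralizerOf 𝔥 (AlmCoh.almostCentralizerIn A 𝔥))
        (AlmCoh.almostCentralizerIn A 𝔥) h) ∧
      Function.Exact (AlmCoh.inflation'
        (AlmCoh.almostCentralizerOf 𝔥 (AlmCoh.almostCentralizerIn A 𝔥))
        (AlmCoh.almostCentralizerIn A 𝔥) h) (AlmCoh.restriction A 𝔥) := by
  -- From here on only the bound `m` is used, no longer definability or dimension.
  obtain ⟨m, hm⟩ := AlmCoh.exists_card_orbit_bound hT M D 𝔥.toSubmodule.toAddSubgroup h𝔥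
  have hI := AlmCoh.relIndex_ne_zero_of_orbit_bound 𝔥.toSubmodule.toAddSubgroup
    (AlmCoh.almostCentralizerOf 𝔥 (AlmCoh.almostCentralizerIn A 𝔥)).toSubmodule.toAddSubgroup
    (AlmCoh.almostCentralizerIn A 𝔥).toSubmodule.toAddSubgroup m
    (fun b hb => AlmCoh.mem_almostCentralizerIn.1 hb)
    (fun b hb => hm b (AlmCoh.mem_almostCentralizerIn.1 hb))
    fun x hx h => AlmCoh.mem_almostCentralizerOf.2 ⟨hx, h⟩
  refine ⟨AlmCoh.lie_eq_zero_of_orbit_bound hA 𝔥 m hm, AlmCoh.inflation'_injective hI _,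
    fun c => ⟨AlmCoh.mem_range_inflation' hA 
    (fun x hx => (AlmCoh.mem_almostCentralizerOf.1 hx).1) _ c, ?_⟩⟩
  rintro ⟨c, rfl⟩
  exact AlmCoh.restriction_inflation' _ hI c
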